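/- Let $N\ge 1$, $\mathbb T=\{0,\dots,N-1\}$, $t\in\mathbb T$, $\mathbb T_t=\{t,\dots,N-1\}$, and let $d\ge 2$ be an integer. Let $(w_k)_{k\in\mathbb T}$ be real random variables on a probability space $(\Omega,\mathcal F,P)$, let $\mathcal F_k=\sigma(w_0,\dots,w_{k-1})$ (with $\mathcal F_0$ trivial), and write $\mathbb E_k=\mathbb E[\,\cdot\mid\mathcal F_k]$. Assume that the $w_k$ are square integrable and that $\mathbb E_k[w_k]=0$ and $\mathbb E_k[w_k^2]=1$ a.s. for all $k\in\mathbb T$. Let $A_k,C_k\in\mathbb R^{n\times n}$, $B_k,D_k\in\mathbb R^{n\times m}$, and let $Q_k,G\in\mathbb R^{n\times n}$, $R_k\in\mathbb R^{m\times m}$ be symmetric (with no definiteness assumption), for $k\in\mathbb T_t$. Throughout, $\mathbb E_{k-d}$ is understood as $\mathbb E_t$ if $k-d<t$. Let $x$ be an $\mathcal F_t$-measurable square-integrable random vector in $\mathbb R^n$. Let $\mathcal U^t_{ad}$ be the set of all $u=(u_t,\dots,u_{N-1})$ of square-integrable $\mathbb R^m$-valued random vectors such that $u_k$ is $\mathcal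 F_{\max(t,k-d)}$-measurable for each $k\in\mathbb T_t$. For $u\in\mathcal U^t_{ad}$ let $$X_{k+1}=(A_kX_k+B_ku_k)+(C_kX_k+D_ku_k)w_k,\quad k\in\mathbb T_t,\qquad X_t=x,$$ $$J(t,x;u)=\sum_{k=t}^{N-1}\mathbb E\big[X_k^TQ_kX_k+u_k^TR_ku_k\big]+\mathbb E\big[X_N^TGX_N\big].$$ A control $\bar u\in\mathcal U^t_{ad}$ is called optimal at $(t,x)$ if $J(t,x;\bar u)=\inf_{u\in\mathcal U^t_{ad}}J(t,x;u)$, and the problem is called solvable at $(t,x)$ if an optimal control exists. Let $M^\dagger$ denote the Moore–Penrose inverse of a matrix $M$ and $\mathrm{Ran}(M)$ its range. Define the matrices $P^{(i)}_k$, $W_k$, $H_k$ by backward recursion as follows: $P^{(0)}_N=G$, $P^{(i)}_N=0$ for $1\le i\le d$, and for $k\in\mathbb T_t$, with $\ell_k=\min(d,k+1-t)$, $$W_k=R_k+\sum_{i=0}^{\ell_k}B_k^TP^{(i)}_{k+1}B_k+D_k^TP^{(0)}_{k+1}D_k,\qquad H_k=\sum_{i=0}^{\ell_k}B_k^TP^{(i)}_{k+1}A_k+D_k^TP^{(0)}_{k+1}C_k,$$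 and, with $\Theta_k=Q_k+A_k^T(P^{(0)}_{k+1}+P^{(1)}_{k+1})A_k+C_k^TP^{(0)}_{k+1}C_k$: * if $k\ge t+d$: $P^{(0)}_k=\Theta_k$, $P^{(i)}_k=A_k^TP^{(i+1)}_{k+1}A_k$ for $1\le i\le d-1$, and $P^{(d)}_k=-H_k^TW_k^\dagger H_k$; * if $t<k<t+d$: $P^{(0)}_k=\Theta_k$, $P^{(i)}_k=A_k^TP^{(i+1)}_{k+1}A_k$ for $1\le i\le k-t-1$, and $P^{(k-t)}_k=A_k^TP^{(k+1-t)}_{k+1}A_k-H_k^TW_k^\dagger H_k$; * if $k=t$: $P^{(0)}_t=\Theta_t-H_t^TW_t^\dagger H_t$. For $u\in\mathcal U^t_{ad}$ let $X^{x,u}$ be the shifted closed-loop state, given by $X^{x,u}_t=x$ and, for $k\in\mathbb T_t$, $$X^{x,u}_{k+1}=\big(A_kX^{x,u}_k-B_kW_k^\dagger H_k\mathbb E_{k-d}X^{x,u}_k+B_ku_k\big)+\big(C_kX^{x,u}_k-D_kW_k^\dagger H_k\mathbb E_{k-d}X^{x,u}_k+D_ku_k\big)w_k .$$ **Theorem.**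 The problem is solvable at $(t,x)$ if and only if both of the following hold: a) $W_k\ge 0$ (positive semidefinite) for all $k\in\mathbb T_t$; b) for every $u\in\mathcal U^t_{ad}$ and every $k\in\mathbb T_t$, $H_k\,\mathbb E_{k-d}X^{x,u}_k\in\mathrm{Ran}(W_k)$ a.s. In that case the control $u^*_k=-W_k^\dagger H_k\,\mathbb E_{k-d}X^*_k$, $k\in\mathbb T_t$, where $X^*=X^{x,0}$ is the closed-loop state with $u=0$, is optimal at $(t,x)$. -/

import Mathlib

open MeasureTheory Matrix

noncomputable section

namespace DelayedLQ

/-! ### The Moore-Penrose inverse of a real matrix -/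

/-- The four Penrose equations: `X` is a Moore-Penrose inverse of `M`. -/
structure IsMoorePenrose {p q : ℕ} (M : Matrix (Fin p) (Fin q) ℝ)
    (X : Matrix (Fin q) (Fin p) ℝ) : Prop where
  mul_mul_self : M * X * M = M
  self_mul_mul : X * M * X = X
  symm_left : (M * X)ᵀ = M * X
  symm_right : (X * M)ᵀ = X * M

theorem exists_isMoorePenrose_of_isSymm {p : ℕ} (M : Matrix (Fin p) (Fin p) ℝ)
    (hM : M.IsSymm) : ∃ X, IsMoorePenrose M X ∧ Xᵀ = X := by
  have hH : M.IsHermitian := by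
    rw [Matrix.IsHermitian, conjTranspose_eq_transpose_of_trivial]
    exact hM
  let U : Matrix (Fin p) (Fin p) ℝ := hH.eigenvectorUnitary
  have hUU : Uᵀ * U = 1 := by
    have h := Unitary.coe_star_mul_self hH.eigenvectorUnitary
    rwa [star_eq_conjTranspose, conjTranspose_eq_transpose_of_trivial] at h
  let E : (Fin p → ℝ) → Matrix (Fin p) (Fin p) ℝ := fun f => U * diagonal f * Uᵀ
  have hmul : ∀ f g, E f * E g = E (fun i => f i * g i) := by
    intro f g
    have h : E f * E g = U * diagonal f * (Uᵀ * U) * diagonal g * Uᵀ := by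
      simp only [E, Matrix.mul_assoc]
    rw [h, hUU, Matrix.mul_one, Matrix.mul_assoc U, diagonal_mul_diagonal]
  have hsymm : ∀ f, (E f)ᵀ = E f := by
    intro f
    simp only [E, transpose_mul, transpose_transpose, diagonal_transpose, Matrix.mul_assoc]
  have hME : M = E hH.eigenvalues := by
    have h := hH.spectral_theorem
    rw [Unitary.conjStarAlgAut_apply] at h
    conv_lhs => rw [h]
    rfl
  let g : Fin p → ℝ := fun i => (hH.eigenvalues i)⁻¹
  refine ⟨E g, ⟨?_, ?_, ?_, ?_⟩, hsymm g⟩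
  · rw [hME, hmul, hmul]
    congr 1
    funext i
    exact mul_inv_mul_cancel _
  · rw [hME, hmul, hmul]
    congr 1
    funext i
    by_cases h : hH.eigenvalues i = 0
    · simp [g, h]
    · simp [g, h]
  · rw [hME, hmul, hsymm]
  · rw [hME, hmul, hsymm]

theorem exists_isMoorePenrose {p q : ℕ} (M : Matrix (Fin p) (Fin q) ℝ) :
    ∃ X, IsMoorePenrose M X := by
  obtain ⟨Y, hY, hYs⟩ := exists_isMoorePenrose_of_isSymm (Mᵀ * M)
    (by simp [Matrix.IsSymm, transpose_mul])
  have hM : M * Y * (Mᵀ * M) = M := by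
    have h0 : Mᵀ * (M * Y * (Mᵀ * M) - M) = 0 := by
      rw [Matrix.mul_sub, sub_eq_zero]
      simpa only [Matrix.mul_assoc] using hY.mul_mul_self
    have h1 : (M * Y * (Mᵀ * M) - M)ᴴ * (M * Y * (Mᵀ * M) - M) = 0 := by
      have h2 : (M * Y * (Mᵀ * M) - M)ᴴ = (Y * (Mᵀ * M) - 1)ᵀ * Mᵀ := by
        rw [conjTranspose_eq_transpose_of_trivial, ← transpose_mul, Matrix.mul_sub,
          Matrix.mul_one, Matrix.mul_assoc M]
      rw [h2, Matrix.mul_assoc, h0, Matrix.mul_zero]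
    exact sub_eq_zero.mp (conjTranspose_mul_self_eq_zero.mp h1)
  refine ⟨Y * Mᵀ, ⟨?_, ?_, ?_, ?_⟩⟩
  · simpa only [Matrix.mul_assoc] using hM
  · have h := congrArg (· * Mᵀ) hY.self_mul_mul
    simpa only [Matrix.mul_assoc] using h
  · simp only [transpose_mul, transpose_transpose, hYs, Matrix.mul_assoc]
  · have h := hY.symm_right
    simpa only [Matrix.mul_assoc] using h

theorem IsMoorePenrose.unique {p q : ℕ} {M : Matrix (Fin p) (Fin q) ℝ}
    {X Y : Matrix (Fin q) (Fin p) ℝ} (hX : IsMoorePenrose M X) (hY : IsMoorePenrose M Y) :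
    X = Y := by
  have h1 : M * X = M * Y := by
    calc M * X = (M * X)ᵀ := hX.symm_left.symm
      _ = (M * Y * (M * X))ᵀ := by rw [← Matrix.mul_assoc, hY.mul_mul_self]
      _ = M * X * (M * Y) := by rw [transpose_mul, hX.symm_left, hY.symm_left]
      _ = M * Y := by rw [← Matrix.mul_assoc, hX.mul_mul_self]
  have h2 : X * M = Y * M := by
    calc X * M = (X * M)ᵀ := hX.symm_right.symm
      _ = (X * M * (Y * M))ᵀ := by
          rw [Matrix.mul_assoc, ← Matrix.mul_assoc M, hY.mul_mul_self]
      _ = Y * M * (X * M) := by rw [transpose_mul, hX.symm_right, hY.symm_right]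
      _ = Y * M := by rw [Matrix.mul_assoc, ← Matrix.mul_assoc M, hX.mul_mul_self]
  calc X = X * M * X := hX.self_mul_mul.symm
    _ = Y * (M * X) := by rw [h2, Matrix.mul_assoc]
    _ = Y := by rw [h1, ← Matrix.mul_assoc, hY.self_mul_mul]

/-- The Moore-Penrose inverse `M†`. -/
def pinv {p q : ℕ} (M : Matrix (Fin p) (Fin q) ℝ) : Matrix (Fin q) (Fin p) ℝ :=
  Classical.choose (exists_isMoorePenrose M)

theorem pinv_spec {p q : ℕ} (M : Matrix (Fin p) (Fin q) ℝ) : IsMoorePenrose M (pinv M) :=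
  Classical.choose_spec (exists_isMoorePenrose M)

/-! ### Data of the problem -/

/-- Horizon `N`, delay `d`, and the deterministic coefficient and weighting matrices.
Only the values at times `k < N` matter. -/
structure LQData (n m : ℕ) where
  N : ℕ
  d : ℕ
  A : ℕ → Matrix (Fin n) (Fin n) ℝ
  B : ℕ → Matrix (Fin n) (Fin m) ℝ
  C : ℕ → Matrix (Fin n) (Fin n) ℝ
  D : ℕ → Matrix (Fin n) (Fin m) ℝ
  Q : ℕ → Matrix (Fin n) (Fin n) ℝ
  R : ℕ → Matrix (Fin m) (Fin m) ℝ
  G : Matrix (Fin n) (Fin n) ℝ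

/-! ### Riccati-like equations -/

/-- The last index of the sums defining `W_k` and `H_k`: `d` if `k ≥ t + d`, and `k + 1 - t` if
`t ≤ k < t + d`. -/
def lastIdx (d t k : ℕ) : ℕ := if t + d ≤ k then d else k + 1 - t

/-- `W_k`, where `P' i` stands for `P^{(i)}_{k+1}`. -/
def wOf {n m : ℕ} (S : LQData n m) (t k : ℕ) (P' : ℕ → Matrix (Fin n) (Fin n) ℝ) :
    Matrix (Fin m) (Fin m) ℝ :=
  S.R k + (∑ i ∈ Finset.range (lastIdx S.d t k + 1), (S.B k)ᵀ * P' i * S.B k)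
    + (S.D k)ᵀ * P' 0 * S.D k

/-- `H_k`, where `P' i` stands for `P^{(i)}_{k+1}`. -/
def hOf {n m : ℕ} (S : LQData n m) (t k : ℕ) (P' : ℕ → Matrix (Fin n) (Fin n) ℝ) :
    Matrix (Fin m) (Fin n) ℝ :=
  (∑ i ∈ Finset.range (lastIdx S.d t k + 1), (S.B k)ᵀ * P' i * S.A k)
    + (S.D k)ᵀ * P' 0 * S.C k

/-- `Q_k + A_kᵀ (P^{(0)}_{k+1} + P^{(1)}_{k+1}) A_k + C_kᵀ P^{(0)}_{k+1} C_k`. -/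
def baseTerm {n m : ℕ} (S : LQData n m) (k : ℕ) (P' : ℕ → Matrix (Fin n) (Fin n) ℝ) :
    Matrix (Fin n) (Fin n) ℝ :=
  S.Q k + (S.A k)ᵀ * (P' 0 + P' 1) * S.A k + (S.C k)ᵀ * P' 0 * S.C k

/-- `H_kᵀ W_k† H_k`. -/
def corrTerm {n m : ℕ} (S : LQData n m) (t k : ℕ) (P' : ℕ → Matrix (Fin n) (Fin n) ℝ) :
    Matrix (Fin n) (Fin n) ℝ :=
  (hOf S t k P')ᵀ * pinv (wOf S t k P') * hOf S t k P'

/-- One backward step of the Riccati-like equations: from `P' i = P^{(i)}_{k+1}` to `P^{(i)}_k`.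
The indices `i > d` (if `k ≥ t + d`) and `i > k - t` (if `t ≤ k < t + d`) do not occur in the
equations, and the value there is set to `0`. -/
def riccatiStep {n m : ℕ} (S : LQData n m) (t k : ℕ) (P' : ℕ → Matrix (Fin n) (Fin n) ℝ)
    (i : ℕ) : Matrix (Fin n) (Fin n) ℝ :=
  if t + S.d ≤ k then
    if i = 0 then baseTerm S k P'
    else if i < S.d then (S.A k)ᵀ * P' (i + 1) * S.A k
    else if i = S.d then - corrTerm S t k P'
    else 0
  else if k = t then
    if i = 0 then baseTerm S k P' - corrTerm S t k P' else 0
  else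
    if i = 0 then baseTerm S k P'
    else if i < k - t then (S.A k)ᵀ * P' (i + 1) * S.A k
    else if i = k - t then (S.A k)ᵀ * P' (i + 1) * S.A k - corrTerm S t k P'
    else 0

/-- The solution of the Riccati-like equations, by the number `s = N - k` of backward steps. -/
def riccatiAux {n m : ℕ} (S : LQData n m) (t : ℕ) : ℕ → ℕ → Matrix (Fin n) (Fin n) ℝ
  | 0 => fun i => if i = 0 then S.G else 0
  | s + 1 => riccatiStep S t (S.N - (s + 1)) (riccatiAux S t s)

/-- `riccatiP S t k i` is `P^{(i)}_k`, for `t ≤ k ≤ N`. -/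
def riccatiP {n m : ℕ} (S : LQData n m) (t k : ℕ) : ℕ → Matrix (Fin n) (Fin n) ℝ :=
  riccatiAux S t (S.N - k)

theorem riccatiP_terminal {n m : ℕ} (S : LQData n m) (t : ℕ) :
    riccatiP S t S.N = fun i => if i = 0 then S.G else 0 := by
  simp [riccatiP, riccatiAux]

theorem riccatiP_step {n m : ℕ} (S : LQData n m) (t k : ℕ) (hk : k < S.N) :
    riccatiP S t k = riccatiStep S t k (riccatiP S t (k + 1)) := by
  obtain ⟨s, hs⟩ : ∃ s, S.N - k = s + 1 := ⟨S.N - k - 1, by omega⟩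
  have h1 : S.N - (s + 1) = k := by omega
  have h2 : S.N - (k + 1) = s := by omega
  simp only [riccatiP, hs, h2, riccatiAux, h1]

/-- `W_k`. -/
def matW {n m : ℕ} (S : LQData n m) (t k : ℕ) : Matrix (Fin m) (Fin m) ℝ :=
  wOf S t k (riccatiP S t (k + 1))

/-- `H_k`. -/
def matH {n m : ℕ} (S : LQData n m) (t k : ℕ) : Matrix (Fin m) (Fin n) ℝ :=
  hOf S t k (riccatiP S t (k + 1))

/-! ### Noise, information, admissible controls

Vectors are elements of `Fin p → ℝ`, whose norm is the maximum norm. The norm enters only through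
`MemLp _ 2`, and square integrability does not depend on the choice of norm in finite dimension. -/

/-- `F_k = σ(w_l : l < k)`; in particular `F_0` is trivial. -/
abbrev infoSigma {Ω : Type*} (w : ℕ → Ω → ℝ) (k : ℕ) : MeasurableSpace Ω :=
  ⨆ l ∈ Finset.range k, MeasurableSpace.comap (w l) inferInstance

/-- `(w_k)_{0 ≤ k < N}` is a square-integrable martingale difference sequence with
`E[w_k | F_k] = 0` and `E[w_k ^ 2 | F_k] = 1`. -/
structure IsNoise {Ω : Type*} [MeasurableSpace Ω] (μ : Measure Ω) (N : ℕ)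
    (w : ℕ → Ω → ℝ) : Prop where
  measurable : ∀ k < N, Measurable (w k)
  memLp : ∀ k < N, MemLp (w k) 2 μ
  condExp_eq_zero : ∀ k < N, μ[w k | infoSigma w k] =ᵐ[μ] fun _ => 0
  condExp_sq_eq_one : ∀ k < N, μ[fun ω => w k ω ^ 2 | infoSigma w k] =ᵐ[μ] fun _ => 1

/-- `ζ` is an `F_k`-measurable square-integrable random vector in `ℝ^p`. -/
def IsL2At {Ω : Type*} [MeasurableSpace Ω] (μ : Measure Ω) (w : ℕ → Ω → ℝ) (k : ℕ) {p : ℕ}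
    (ζ : Ω → Fin p → ℝ) : Prop :=
  Measurable[infoSigma w k] ζ ∧ MemLp ζ 2 μ

/-- The time index of the information available to the controller at time `k`:
`t` if `k ≤ t + d`, and `k - d` if `k ≥ t + d`. -/
def infoTime (d t k : ℕ) : ℕ := max t (k - d)

/-- `u` is an admissible control on `{t, …, N - 1}`: `u_k` is square integrable,
`F_t`-measurable for `k ≤ t + d` and `F_{k-d}`-measurable for `k ≥ t + d`. The values `u k` for
`k` outside `{t, …, N - 1}` are not used. -/
def IsAdmissible {n m : ℕ} {Ω : Type*} [MeasurableSpace Ω] (μ : Measure Ω) (S : LQData n m)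
    (w : ℕ → Ω → ℝ) (t : ℕ) (u : ℕ → Ω → Fin m → ℝ) : Prop :=
  ∀ k, t ≤ k → k < S.N → IsL2At μ w (infoTime S.d t k) (u k)

/-- `E_{k-d} Y`, which is understood as `E_t Y` if `k - d < t`. -/
def delayedExp {Ω : Type*} [MeasurableSpace Ω] (μ : Measure Ω) (w : ℕ → Ω → ℝ) (d t k : ℕ)
    {p : ℕ} (Y : Ω → Fin p → ℝ) : Ω → Fin p → ℝ :=
  μ[Y | infoSigma w (infoTime d t k)]

/-! ### State equations, cost, optimality -/

/-- The state `X` of the controlled system with `X_t = x` (and, by convention, `X_k = x` for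
`k < t`). -/
def state {n m : ℕ} {Ω : Type*} (S : LQData n m) (w : ℕ → Ω → ℝ) (t : ℕ)
    (x : Ω → Fin n → ℝ) (u : ℕ → Ω → Fin m → ℝ) : ℕ → Ω → Fin n → ℝ
  | 0 => x
  | k + 1 =>
    if t ≤ k then fun ω =>
      (S.A k *ᵥ state S w t x u k ω + S.B k *ᵥ u k ω)
        + w k ω • (S.C k *ᵥ state S w t x u k ω + S.D k *ᵥ u k ω)
    else x

/-- The shifted closed-loop state `X^{x,u}`, i.e. the solution of
`X_{k+1} = (A_k X_k - B_k W_k† H_k E_{k-d} X_k + B_k u_k)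
  + (C_k X_k - D_k W_k† H_k E_{k-d} X_k + D_k u_k) w_k`, `X_t = x`
(and, by convention, `X_k = x` for `k < t`). -/
def shiftedState {n m : ℕ} {Ω : Type*} [MeasurableSpace Ω] (μ : Measure Ω) (S : LQData n m)
    (w : ℕ → Ω → ℝ) (t : ℕ) (x : Ω → Fin n → ℝ) (u : ℕ → Ω → Fin m → ℝ) :
    ℕ → Ω → Fin n → ℝ
  | 0 => x
  | k + 1 =>
    if t ≤ k then fun ω =>
      (S.A k *ᵥ shiftedState μ S w t x u k ω
          - (S.B k * pinv (matW S t k) * matH S t k) *ᵥ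
              delayedExp μ w S.d t k (shiftedState μ S w t x u k) ω
          + S.B k *ᵥ u k ω)
        + w k ω •
          (S.C k *ᵥ shiftedState μ S w t x u k ω
            - (S.D k * pinv (matW S t k) * matH S t k) *ᵥ
                delayedExp μ w S.d t k (shiftedState μ S w t x u k) ω
            + S.D k *ᵥ u k ω)
    else x

/-- The closed-loop state `X^{t,x,*}`: the system driven by the feedback alone. -/
def closedLoopState {n m : ℕ} {Ω : Type*} [MeasurableSpace Ω] (μ : Measure Ω) (S : LQData n m)
    (w : ℕ → Ω → ℝ) (t : ℕ) (x : Ω → Fin n → ℝ) : ℕ → Ω → Fin n → ℝ :=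
  shiftedState μ S w t x (fun _ _ => 0)

/-- The feedback control `u_k = -W_k† H_k E_{k-d} X^{t,x,*}_k`. -/
def feedback {n m : ℕ} {Ω : Type*} [MeasurableSpace Ω] (μ : Measure Ω) (S : LQData n m)
    (w : ℕ → Ω → ℝ) (t : ℕ) (x : Ω → Fin n → ℝ) (k : ℕ) (ω : Ω) : Fin m → ℝ :=
  - ((pinv (matW S t k) * matH S t k) *ᵥ
      delayedExp μ w S.d t k (closedLoopState μ S w t x k) ω)

/-- The cost functional `J(t, x; u)`. -/
def cost {n m : ℕ} {Ω : Type*} [MeasurableSpace Ω] (μ : Measure Ω) (S : LQData n m)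
    (w : ℕ → Ω → ℝ) (t : ℕ) (x : Ω → Fin n → ℝ) (u : ℕ → Ω → Fin m → ℝ) : ℝ :=
  (∑ k ∈ Finset.Ico t S.N,
      ∫ ω, (state S w t x u k ω ⬝ᵥ (S.Q k *ᵥ state S w t x u k ω)
        + u k ω ⬝ᵥ (S.R k *ᵥ u k ω)) ∂μ)
    + ∫ ω, state S w t x u S.N ω ⬝ᵥ (S.G *ᵥ state S w t x u S.N ω) ∂μ

/-- `u` is an optimal control for the initial pair `(t, x)`: it is admissible and attains the
infimum of the cost over all admissible controls. -/
def IsOptimalControl {n m : ℕ} {Ω : Type*} [MeasurableSpace Ω] (μ : Measure Ω) (S : LQData n m)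
    (w : ℕ → Ω → ℝ) (t : ℕ) (x : Ω → Fin n → ℝ) (u : ℕ → Ω → Fin m → ℝ) : Prop :=
  IsAdmissible μ S w t u ∧
    ∀ v, IsAdmissible μ S w t v → cost μ S w t x u ≤ cost μ S w t x v

/-- The problem is solvable at the initial pair `(t, x)`. -/
def IsSolvable {n m : ℕ} {Ω : Type*} [MeasurableSpace Ω] (μ : Measure Ω) (S : LQData n m)
    (w : ℕ → Ω → ℝ) (t : ℕ) (x : Ω → Fin n → ℝ) : Prop :=
  ∃ u, IsOptimalControl μ S w t x u

end DelayedLQ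

end

noncomputable section

namespace DelayedLQ

/-! ### Square-integrable random vectors and bilinear expectations -/

section Expectation

variable {Ω : Type*} [MeasurableSpace Ω] {μ : Measure Ω} {p q r : ℕ}

/-! The proof is a completion of squares adapted to delayed information. Take V_k(X) = ∑_{i ≤ d}
E[(E_{k-i}X)ᵀ P^{(i)}_k (E_{k-i}X)], with conditioning times truncated below at t. Passing from k to
k+1 shifts the lag: E_{(k+1)-(i+1)} = E_{k-i} averages the noise out of X_{k+1} and leaves A
E_{k-i}X + B u, because u_k is already known at that time. Only lag 0 sees the noise. The
Riccati-like equations are exactly what makes stage cost plus V_{k+1}(X_{k+1}) equal V_k(X_k) plus a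
quadratic expression in u_k and E_{k-d}X_k with matrices W_k, H_k and H_kᵀW_k†H_k
(`stage_add_value_nextState`). Telescoping gives `cost_eq`.

Every admissible control has the form u_k = g_k - W_k†H_k E_{k-d}X_k with g admissible, and then
(`cost_shiftedControl`) J = V_t(x) + ∑_k (E[g_kᵀW_k g_k] + 2 E[g_kᵀ(1 - W_kW_k†)H_k
E_{k-d}X^{x,g}_k]). Under a) and b) the linear terms vanish and the quadratic ones are nonnegative,
so g = 0 is optimal. Conversely, let g equal u before k, s·e at k and 0 afterwards: the cost is a
quadratic polynomial in s, bounded below. A constant e yields W_k ≥ 0; e = (1 - W_kW_k†)H_k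
E_{k-d}X_k kills the quadratic coefficient, so the linear one, 2E|e|², is zero, which is b). -/

theorem memLp_mulVec {Y : Ω → Fin q → ℝ} (M : Matrix (Fin p) (Fin q) ℝ) (hY : MemLp Y 2 μ) :
    MemLp (fun ω => M *ᵥ Y ω) 2 μ :=
  (LinearMap.toContinuousLinearMap M.mulVecLin).comp_memLp' hY

theorem integrable_dotProduct {Y Z : Ω → Fin p → ℝ} (hY : MemLp Y 2 μ) (hZ : MemLp Z 2 μ) :
    Integrable (fun ω => Y ω ⬝ᵥ Z ω) μ :=
  integrable_finsetSum _ fun i _ => (hY.eval i).integrable_mul (hZ.eval i)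

/-- `E[Yᵀ M Z]`. -/
def bilinExp (μ : Measure Ω) (M : Matrix (Fin p) (Fin q) ℝ) (Y : Ω → Fin p → ℝ)
    (Z : Ω → Fin q → ℝ) : ℝ :=
  ∫ ω, Y ω ⬝ᵥ (M *ᵥ Z ω) ∂μ

theorem integrable_bilin (M : Matrix (Fin p) (Fin q) ℝ) {Y : Ω → Fin p → ℝ} {Z : Ω → Fin q → ℝ}
    (hY : MemLp Y 2 μ) (hZ : MemLp Z 2 μ) : Integrable (fun ω => Y ω ⬝ᵥ (M *ᵥ Z ω)) μ :=
  integrable_dotProduct hY (memLp_mulVec M hZ)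

theorem bilinExp_congr (M : Matrix (Fin p) (Fin q) ℝ) {Y Y' : Ω → Fin p → ℝ}
    {Z Z' : Ω → Fin q → ℝ} (hY : Y =ᵐ[μ] Y') (hZ : Z =ᵐ[μ] Z') :
    bilinExp μ M Y Z = bilinExp μ M Y' Z' := by
  refine integral_congr_ae ?_
  filter_upwards [hY, hZ] with ω h1 h2
  rw [h1, h2]

theorem bilinExp_transpose (M : Matrix (Fin p) (Fin q) ℝ) (Y : Ω → Fin p → ℝ)
    (Z : Ω → Fin q → ℝ) : bilinExp μ Mᵀ Z Y = bilinExp μ M Y Z := by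
  refine integral_congr_ae (Filter.Eventually.of_forall fun ω => ?_)
  simp only
  rw [mulVec_transpose, dotProduct_comm, dotProduct_mulVec]

theorem bilinExp_add_matrix (M M' : Matrix (Fin p) (Fin q) ℝ) {Y : Ω → Fin p → ℝ}
    {Z : Ω → Fin q → ℝ} (hY : MemLp Y 2 μ) (hZ : MemLp Z 2 μ) :
    bilinExp μ (M + M') Y Z = bilinExp μ M Y Z + bilinExp μ M' Y Z := by
  simp only [bilinExp, add_mulVec, dotProduct_add]
  exact integral_add (integrable_bilin M hY hZ) (integrable_bilin M' hY hZ)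

theorem bilinExp_neg_matrix (M : Matrix (Fin p) (Fin q) ℝ) (Y : Ω → Fin p → ℝ)
    (Z : Ω → Fin q → ℝ) : bilinExp μ (-M) Y Z = - bilinExp μ M Y Z := by
  simp only [bilinExp, neg_mulVec, dotProduct_neg, integral_neg]

theorem bilinExp_sub_matrix (M M' : Matrix (Fin p) (Fin q) ℝ) {Y : Ω → Fin p → ℝ}
    {Z : Ω → Fin q → ℝ} (hY : MemLp Y 2 μ) (hZ : MemLp Z 2 μ) :
    bilinExp μ (M - M') Y Z = bilinExp μ M Y Z - bilinExp μ M' Y Z := by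
  rw [sub_eq_add_neg, bilinExp_add_matrix _ _ hY hZ, bilinExp_neg_matrix, ← sub_eq_add_neg]

theorem bilinExp_zero_matrix (Y : Ω → Fin p → ℝ) (Z : Ω → Fin q → ℝ) :
    bilinExp μ 0 Y Z = 0 := by
  simp [bilinExp]

theorem bilinExp_sum_matrix {ι : Type*} (s : Finset ι) (M : ι → Matrix (Fin p) (Fin q) ℝ)
    {Y : Ω → Fin p → ℝ} {Z : Ω → Fin q → ℝ} (hY : MemLp Y 2 μ) (hZ : MemLp Z 2 μ) :
    bilinExp μ (∑ i ∈ s, M i) Y Z = ∑ i ∈ s, bilinExp μ (M i) Y Z := by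
  simp only [bilinExp, sum_mulVec, dotProduct_sum]
  exact integral_finsetSum _ fun i _ => integrable_bilin (M i) hY hZ

theorem bilinExp_add_left (M : Matrix (Fin p) (Fin q) ℝ) {Y Y' : Ω → Fin p → ℝ}
    {Z : Ω → Fin q → ℝ} (hY : MemLp Y 2 μ) (hY' : MemLp Y' 2 μ) (hZ : MemLp Z 2 μ) :
    bilinExp μ M (fun ω => Y ω + Y' ω) Z = bilinExp μ M Y Z + bilinExp μ M Y' Z := by
  simp only [bilinExp, add_dotProduct]
  exact integral_add (integrable_bilin M hY hZ) (integrable_bilin M hY' hZ)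

theorem bilinExp_add_right (M : Matrix (Fin p) (Fin q) ℝ) {Y : Ω → Fin p → ℝ}
    {Z Z' : Ω → Fin q → ℝ} (hY : MemLp Y 2 μ) (hZ : MemLp Z 2 μ) (hZ' : MemLp Z' 2 μ) :
    bilinExp μ M Y (fun ω => Z ω + Z' ω) = bilinExp μ M Y Z + bilinExp μ M Y Z' := by
  simp only [bilinExp, mulVec_add, dotProduct_add]
  exact integral_add (integrable_bilin M hY hZ) (integrable_bilin M hY hZ')

theorem bilinExp_mulVec_mulVec {p' q' : ℕ} (M : Matrix (Fin p) (Fin q) ℝ)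
    (K : Matrix (Fin p) (Fin p') ℝ) (L : Matrix (Fin q) (Fin q') ℝ)
    (Y : Ω → Fin p' → ℝ) (Z : Ω → Fin q' → ℝ) :
    bilinExp μ M (fun ω => K *ᵥ Y ω) (fun ω => L *ᵥ Z ω) = bilinExp μ (Kᵀ * M * L) Y Z := by
  refine integral_congr_ae (Filter.Eventually.of_forall fun ω => ?_)
  simp only [← mulVec_mulVec]
  rw [mulVec_transpose, dotProduct_comm (Y ω), ← dotProduct_mulVec, dotProduct_comm]

/-- Expansion of the quadratic form at `A Y + B u`. -/
theorem bilinExp_affine {M : Matrix (Fin p) (Fin p) ℝ} (hM : M.IsSymm)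
    (A : Matrix (Fin p) (Fin q) ℝ) (B : Matrix (Fin p) (Fin r) ℝ) {Y : Ω → Fin q → ℝ}
    {u : Ω → Fin r → ℝ} (hY : MemLp Y 2 μ) (hu : MemLp u 2 μ) :
    bilinExp μ M (fun ω => A *ᵥ Y ω + B *ᵥ u ω) (fun ω => A *ᵥ Y ω + B *ᵥ u ω)
      = bilinExp μ (Aᵀ * M * A) Y Y + 2 * bilinExp μ (Bᵀ * M * A) u Y
        + bilinExp μ (Bᵀ * M * B) u u := by
  have hA := memLp_mulVec A hY
  have hB := memLp_mulVec B hu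
  have hAB : MemLp (fun ω => A *ᵥ Y ω + B *ᵥ u ω) 2 μ := hA.add hB
  have ht : bilinExp μ (Aᵀ * M * B) Y u = bilinExp μ (Bᵀ * M * A) u Y := by
    rw [← bilinExp_transpose]
    simp only [transpose_mul, transpose_transpose, hM.eq, Matrix.mul_assoc]
  rw [bilinExp_add_left M hA hB hAB, bilinExp_add_right M hA hA hB, bilinExp_add_right M hB hA hB]
  simp only [bilinExp_mulVec_mulVec, ht]
  ring

end Expectation

/-! ### Conditional expectations -/

section CondExp

variable {Ω : Type*} {m₀ mΩ : MeasurableSpace Ω} {μ : Measure Ω} {p q : ℕ}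

theorem condExp_mulVec (M : Matrix (Fin p) (Fin q) ℝ) {Y : Ω → Fin q → ℝ}
    (hY : Integrable Y μ) :
    μ[fun ω => M *ᵥ Y ω | m₀] =ᵐ[μ] fun ω => M *ᵥ (μ[Y | m₀]) ω :=
  ((LinearMap.toContinuousLinearMap M.mulVecLin).comp_condExp_comm hY (m := m₀)).symm

variable [IsProbabilityMeasure μ]

/-- `E[Uᵀ M Y] = E[Uᵀ M E[Y | m₀]]` if `U` is `m₀`-measurable. -/
theorem bilinExp_condExp_right (hm : m₀ ≤ mΩ) (M : Matrix (Fin p) (Fin q) ℝ) {U : Ω → Fin p → ℝ}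
    {Y : Ω → Fin q → ℝ} (hU : StronglyMeasurable[m₀] U) (hU2 : MemLp U 2 μ) (hY : MemLp Y 2 μ) :
    bilinExp μ M U (μ[Y | m₀]) = bilinExp μ M U Y := by
  -- The form is packaged as a continuous bilinear map so that the measurable factor U can be pulled
  -- out of the conditional expectation.
  let T : (Fin p → ℝ) →L[ℝ] (Fin q → ℝ) →L[ℝ] ℝ :=
    (Matrix.toLinearMap₂' ℝ M).toContinuousBilinearMap
  have hT : ∀ a b, T a b = a ⬝ᵥ (M *ᵥ b) := fun a b =>
    Matrix.toLinearMap₂'_apply' M a b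
  have h := condExp_bilin_of_stronglyMeasurable_left T hU (g := Y)
    (by simpa only [hT] using integrable_bilin M hU2 hY) (hY.integrable one_le_two)
  simp only [hT] at h
  rw [bilinExp, ← integral_congr_ae h, integral_condExp hm]
  rfl

variable {v : Ω → ℝ}

theorem integral_mul_eq_zero_of_condExp (hm : m₀ ≤ mΩ) (hv : Integrable v μ)
    (h0 : μ[v | m₀] =ᵐ[μ] fun _ => 0) {f : Ω → ℝ} (hf : StronglyMeasurable[m₀] f)
    (hfv : Integrable (f * v) μ) : ∫ ω, f ω * v ω ∂μ = 0 := by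
  have h := condExp_mul_of_stronglyMeasurable_left hf hfv hv
  have h' : ∫ ω, (f * v) ω ∂μ = 0 := by
    rw [← integral_condExp hm, integral_congr_ae h]
    refine integral_eq_zero_of_ae ?_
    filter_upwards [h0] with ω hω
    simp [hω]
  exact h'

theorem integral_mul_of_condExp_eq_one (hm : m₀ ≤ mΩ) (hv : Integrable v μ)
    (h1 : μ[v | m₀] =ᵐ[μ] fun _ => 1) {f : Ω → ℝ} (hf : StronglyMeasurable[m₀] f)
    (hfv : Integrable (f * v) μ) : ∫ ω, f ω * v ω ∂μ = ∫ ω, f ω ∂μ := by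
  have h := condExp_mul_of_stronglyMeasurable_left hf hfv hv
  have h' : ∫ ω, (f * v) ω ∂μ = ∫ ω, f ω ∂μ := by
    rw [← integral_condExp hm, integral_congr_ae h]
    refine integral_congr_ae ?_
    filter_upwards [h1] with ω hω
    simp [hω]
  exact h'

/-- A weight with conditional expectation `1` does not change the integral of nonnegative
`m₀`-measurable functions. -/
theorem lintegral_mul_of_condExp_eq_one (hm : m₀ ≤ mΩ) (hv : Integrable v μ) (hv0 : 0 ≤ v)
    (h1 : μ[v | m₀] =ᵐ[μ] fun _ => 1) {f : Ω → ENNReal} (hf : Measurable[m₀] f) :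
    ∫⁻ ω, ENNReal.ofReal (v ω) * f ω ∂μ = ∫⁻ ω, f ω ∂μ := by
  -- The measures v dμ and μ agree on m₀: over an m₀-measurable set, v integrates like its
  -- conditional expectation 1.
  have htrim : (μ.withDensity fun ω => ENNReal.ofReal (v ω)).trim hm = μ.trim hm := by
    refine @Measure.ext _ m₀ _ _ fun s hs => ?_
    rw [trim_measurableSet_eq hm hs, trim_measurableSet_eq hm hs,
      withDensity_apply _ (hm s hs),
      ← ofReal_integral_eq_lintegral_ofReal hv.integrableOn (Filter.Eventually.of_forall hv0),
      ← setIntegral_condExp hm hv hs,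
      setIntegral_congr_ae (g := fun _ => (1 : ℝ)) (hm s hs) (h1.mono fun ω h _ => h)]
    simp
  have h := lintegral_trim (μ := μ.withDensity fun ω => ENNReal.ofReal (v ω)) hm hf
  rw [htrim, lintegral_trim hm hf] at h
  rw [h, lintegral_withDensity_eq_lintegral_mul₀ hv.aemeasurable.ennreal_ofReal
    (hf.mono hm le_rfl).aemeasurable]
  rfl

/-- A product of two L² functions is in general only L¹. Here |Y|² is m₀-measurable, so E[v²|Y|²] =
E|Y|²; the computation uses Lebesgue integrals in [0, ∞] because integrability is not yet known. -/
theorem memLp_smul_of_condExp_sq_eq_one (hm : m₀ ≤ mΩ) (hv : MemLp v 2 μ)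
    (h1 : μ[fun ω => v ω ^ 2 | m₀] =ᵐ[μ] fun _ => 1) {Y : Ω → Fin p → ℝ}
    (hY : Measurable[m₀] Y) (hY2 : MemLp Y 2 μ) : MemLp (fun ω => v ω • Y ω) 2 μ := by
  have hmeas : AEStronglyMeasurable (fun ω => v ω • Y ω) μ :=
    hv.aestronglyMeasurable.smul hY2.aestronglyMeasurable
  refine ⟨hmeas, ?_⟩
  rw [eLpNorm_lt_top_iff_lintegral_rpow_enorm_lt_top two_ne_zero ENNReal.ofNat_ne_top]
  have h2 := hY2.2
  rw [eLpNorm_lt_top_iff_lintegral_rpow_enorm_lt_top two_ne_zero ENNReal.ofNat_ne_top] at h2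
  have hf : Measurable[m₀] fun ω => ‖Y ω‖ₑ ^ (2 : ENNReal).toReal :=
    (continuous_enorm.measurable.comp hY).pow_const _
  rw [← lintegral_mul_of_condExp_eq_one hm hv.integrable_sq (fun ω => sq_nonneg _) h1 hf] at h2
  convert h2 using 3 with ω
  rw [enorm_smul, ENNReal.mul_rpow_of_nonneg _ _ ENNReal.toReal_nonneg]
  congr 1
  rw [Real.enorm_eq_ofReal_abs, ENNReal.toReal_ofNat, ENNReal.rpow_ofNat,
    ← ENNReal.ofReal_pow (abs_nonneg _), sq_abs]

/-- `E[|ζ + v η|_M²] = E[|ζ|_M²] + E[|η|_M²]` for a noise `v` with conditional mean `0` and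
conditional variance `1`. -/
theorem bilinExp_add_noise (hm : m₀ ≤ mΩ) (hv : MemLp v 2 μ) (h0 : μ[v | m₀] =ᵐ[μ] fun _ => 0)
    (h1 : μ[fun ω => v ω ^ 2 | m₀] =ᵐ[μ] fun _ => 1) (M : Matrix (Fin p) (Fin p) ℝ)
    {Y Z : Ω → Fin p → ℝ} (hY : Measurable[m₀] Y) (hZ : Measurable[m₀] Z)
    (hY2 : MemLp Y 2 μ) (hZ2 : MemLp Z 2 μ) :
    bilinExp μ M (fun ω => Y ω + v ω • Z ω) (fun ω => Y ω + v ω • Z ω)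
      = bilinExp μ M Y Y + bilinExp μ M Z Z := by
  have hvZ := memLp_smul_of_condExp_sq_eq_one hm hv h1 hZ hZ2
  have hs : ∀ {U V : Ω → Fin p → ℝ}, Measurable[m₀] U → Measurable[m₀] V →
      StronglyMeasurable[m₀] fun ω => U ω ⬝ᵥ (M *ᵥ V ω) := by
    intro U V hU hV
    refine Measurable.stronglyMeasurable ?_
    have hV' : Measurable[m₀] fun ω => M *ᵥ V ω :=
      (LinearMap.toContinuousLinearMap M.mulVecLin).continuous.measurable.comp hV
    refine Finset.measurable_sum _ fun i _ => ?_
    exact ((measurable_pi_apply i).comp hU).mul ((measurable_pi_apply i).comp hV')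
  have hcross : ∀ {U V : Ω → Fin p → ℝ}, Measurable[m₀] U → Measurable[m₀] V →
      Integrable (fun ω => (U ω ⬝ᵥ (M *ᵥ V ω)) * v ω) μ →
      ∫ ω, (U ω ⬝ᵥ (M *ᵥ V ω)) * v ω ∂μ = 0 := fun hU hV hi =>
    integral_mul_eq_zero_of_condExp hm (hv.integrable one_le_two) h0 (hs hU hV) hi
  have e1 : bilinExp μ M Y (fun ω => v ω • Z ω) = 0 := by
    have hi := integrable_bilin M hY2 hvZ
    simp only [bilinExp, mulVec_smul, dotProduct_smul, smul_eq_mul, mul_comm (v _)] at hi ⊢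
    exact hcross hY hZ hi
  have e2 : bilinExp μ M (fun ω => v ω • Z ω) Y = 0 := by
    have hi := integrable_bilin M hvZ hY2
    simp only [bilinExp, smul_dotProduct, smul_eq_mul, mul_comm (v _)] at hi ⊢
    exact hcross hZ hY hi
  have e3 : bilinExp μ M (fun ω => v ω • Z ω) (fun ω => v ω • Z ω) = bilinExp μ M Z Z := by
    have hi := integrable_bilin M hvZ hvZ
    have heq : ∀ ω, (v ω • Z ω) ⬝ᵥ (M *ᵥ (v ω • Z ω)) = (Z ω ⬝ᵥ (M *ᵥ Z ω)) * v ω ^ 2 := by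
      intro ω
      simp only [mulVec_smul, dotProduct_smul, smul_dotProduct, smul_eq_mul]
      ring
    simp only [bilinExp, heq] at hi ⊢
    exact integral_mul_of_condExp_eq_one hm hv.integrable_sq h1 (hs hZ hZ) hi
  have hadd : MemLp (fun ω => Y ω + v ω • Z ω) 2 μ := hY2.add hvZ
  rw [bilinExp_add_left M hY2 hvZ hadd, bilinExp_add_right M hY2 hY2 hvZ,
    bilinExp_add_right M hvZ hY2 hvZ, e1, e2, e3]
  ring

/-- The conditional expectation of a noise term given less information vanishes. -/
theorem condExp_smul_noise_eq_zero {m₁ : MeasurableSpace Ω} (hm : m₀ ≤ mΩ) (h10 : m₁ ≤ m₀)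
    (hv : MemLp v 2 μ) (h0 : μ[v | m₀] =ᵐ[μ] fun _ => 0)
    (h1 : μ[fun ω => v ω ^ 2 | m₀] =ᵐ[μ] fun _ => 1)
    {Z : Ω → Fin p → ℝ} (hZ : Measurable[m₀] Z) (hZ2 : MemLp Z 2 μ) :
    μ[fun ω => v ω • Z ω | m₁] =ᵐ[μ] fun _ => 0 := by
  have hvZ := memLp_smul_of_condExp_sq_eq_one hm hv h1 hZ hZ2
  have h := condExp_smul_of_aestronglyMeasurable_right (m := m₀) (f := v) (g := Z)
    (hv.integrable one_le_two) (hvZ.integrable one_le_two)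
    hZ.stronglyMeasurable.aestronglyMeasurable
  have h' : μ[fun ω => v ω • Z ω | m₀] =ᵐ[μ] fun _ => 0 := by
    refine h.trans ?_
    filter_upwards [h0] with ω hω
    simp [hω]
  refine (condExp_condExp_of_le h10 hm).symm.trans ((condExp_congr_ae h').trans ?_)
  exact Filter.EventuallyEq.of_eq (condExp_zero (E := Fin p → ℝ))

end CondExp

/-! ### Moore-Penrose inverses of symmetric matrices -/

/-- The spectral construction yields a symmetric Moore-Penrose inverse, and uniqueness identifies it
with the chosen one. -/
theorem pinv_isSymm {p : ℕ} {M : Matrix (Fin p) (Fin p) ℝ} (hM : M.IsSymm) : (pinv M).IsSymm := by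
  obtain ⟨X, hX, hXs⟩ := exists_isMoorePenrose_of_isSymm M hM
  rw [(pinv_spec M).unique hX]
  exact hXs

/-- `M * pinv M` is the projection onto the range of `M`; this turns the range condition into a
linear equation. -/
theorem mem_range_mulVecLin_iff {p q : ℕ} (M : Matrix (Fin p) (Fin q) ℝ) (y : Fin p → ℝ) :
    y ∈ LinearMap.range M.mulVecLin ↔ (M * pinv M) *ᵥ y = y := by
  constructor
  · rintro ⟨z, rfl⟩
    rw [mulVecLin_apply, mulVec_mulVec, (pinv_spec M).mul_mul_self]
  · intro h
    exact ⟨pinv M *ᵥ y, by rw [mulVecLin_apply, mulVec_mulVec, h]⟩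

/-! ### Riccati-like equations -/

section Riccati

variable {n m : ℕ} (S : LQData n m) {t k : ℕ}

/-- Lags beyond min(d, k - t) carry no weight. This allows all sums over lags to run up to d,
whatever the position of k relative to t + d. -/
theorem riccatiP_eq_zero (hd : 2 ≤ S.d) (hk : t ≤ k) (hkN : k ≤ S.N) {i : ℕ}
    (hi : min S.d (k - t) < i) : riccatiP S t k i = 0 := by
  have hi0 : i ≠ 0 := by omega
  rcases hkN.eq_or_lt with rfl | hlt
  · simp [riccatiP_terminal, hi0]
  · rw [riccatiP_step S t k hlt, riccatiStep]
    split_ifs <;> first | rfl | omega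

/-- Merges the three regimes of the recursion: a pure lag shift, with the correction charged to the
lag min(d, k - t), whose conditioning time is the controller's information time. -/
theorem riccatiP_eq (hd : 2 ≤ S.d) (hk : t ≤ k) (hkN : k < S.N) (i : ℕ) :
    riccatiP S t k i =
      (if i = 0 then baseTerm S k (riccatiP S t (k + 1))
        else (S.A k)ᵀ * riccatiP S t (k + 1) (i + 1) * S.A k)
      - (if min S.d (k - t) = i then corrTerm S t k (riccatiP S t (k + 1)) else 0) := by
  have hz : min S.d (k + 1 - t) < i + 1 → riccatiP S t (k + 1) (i + 1) = 0 :=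
    riccatiP_eq_zero S hd (by omega) hkN
  rw [riccatiP_step S t k hkN, riccatiStep]
  split_ifs <;> first
    | omega
    | rfl
    | (rw [hz (by omega)]; simp)
    | rw [sub_zero]

theorem sum_lastIdx {M : Type*} [AddCommMonoid M] (hd : 2 ≤ S.d) (hk : t ≤ k) (hkN : k < S.N)
    (f : ℕ → Matrix (Fin n) (Fin n) ℝ → M) (hf : ∀ i, f i 0 = 0) :
    ∑ i ∈ Finset.range (lastIdx S.d t k + 1), f i (riccatiP S t (k + 1) i)
      = ∑ i ∈ Finset.range (S.d + 1), f i (riccatiP S t (k + 1) i) := by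
  have hl : lastIdx S.d t k = min S.d (k + 1 - t) := by
    unfold lastIdx
    split_ifs <;> omega
  refine Finset.sum_subset (Finset.range_subset_range.2 (by omega)) fun i _ hi => ?_
  rw [Finset.mem_range, hl] at hi
  rw [riccatiP_eq_zero S hd (by omega) hkN (by omega), hf]

theorem matW_eq (hd : 2 ≤ S.d) (hk : t ≤ k) (hkN : k < S.N) :
    matW S t k = S.R k
      + (∑ i ∈ Finset.range (S.d + 1), (S.B k)ᵀ * riccatiP S t (k + 1) i * S.B k)
      + (S.D k)ᵀ * riccatiP S t (k + 1) 0 * S.D k := by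
  rw [matW, wOf, sum_lastIdx S hd hk hkN (fun _ P => (S.B k)ᵀ * P * S.B k) (by simp)]

theorem matH_eq (hd : 2 ≤ S.d) (hk : t ≤ k) (hkN : k < S.N) :
    matH S t k = (∑ i ∈ Finset.range (S.d + 1), (S.B k)ᵀ * riccatiP S t (k + 1) i * S.A k)
      + (S.D k)ᵀ * riccatiP S t (k + 1) 0 * S.C k := by
  rw [matH, hOf, sum_lastIdx S hd hk hkN (fun _ P => (S.B k)ᵀ * P * S.A k) (by simp)]

theorem isSymm_conj {p q : ℕ} {M : Matrix (Fin p) (Fin p) ℝ} (hM : M.IsSymm)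
    (K : Matrix (Fin p) (Fin q) ℝ) : (Kᵀ * M * K).IsSymm := by
  simp only [Matrix.IsSymm, transpose_mul, transpose_transpose, hM.eq, Matrix.mul_assoc]

theorem wOf_isSymm (hR : (S.R k).IsSymm) {P' : ℕ → Matrix (Fin n) (Fin n) ℝ}
    (hP : ∀ i, (P' i).IsSymm) : (wOf S t k P').IsSymm := by
  refine (hR.add ?_).add (isSymm_conj (hP 0) _)
  rw [Matrix.IsSymm, transpose_sum]
  exact Finset.sum_congr rfl fun i _ => isSymm_conj (hP i) _

theorem riccatiStep_isSymm (hQ : (S.Q k).IsSymm) (hR : (S.R k).IsSymm)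
    {P' : ℕ → Matrix (Fin n) (Fin n) ℝ} (hP : ∀ i, (P' i).IsSymm) (i : ℕ) :
    (riccatiStep S t k P' i).IsSymm := by
  have hb : (baseTerm S k P').IsSymm :=
    (hQ.add (isSymm_conj ((hP 0).add (hP 1)) _)).add (isSymm_conj (hP 0) _)
  have hc : (corrTerm S t k P').IsSymm := isSymm_conj (pinv_isSymm (wOf_isSymm S hR hP)) _
  have hA := isSymm_conj (hP (i + 1)) (S.A k)
  have hz : (0 : Matrix (Fin n) (Fin n) ℝ).IsSymm := transpose_zero
  unfold riccatiStep
  split_ifs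
  exacts [hb, hA, hc.neg, hz, hb.sub hc, hz, hb, hA, hA.sub hc, hz]

theorem riccatiP_isSymm (hQ : ∀ k, t ≤ k → k < S.N → (S.Q k).IsSymm)
    (hR : ∀ k, t ≤ k → k < S.N → (S.R k).IsSymm) (hG : S.G.IsSymm) (hk : t ≤ k)
    (hkN : k ≤ S.N) (i : ℕ) : (riccatiP S t k i).IsSymm := by
  induction hkN using Nat.decreasingInduction generalizing i with
  | self =>
    rw [riccatiP_terminal]
    dsimp only
    split_ifs
    exacts [hG, transpose_zero]
  | of_succ k hlt ih =>
    rw [riccatiP_step S t k hlt]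
    exact riccatiStep_isSymm S (hQ k hk hlt) (hR k hk hlt) (ih (by omega)) i

theorem matW_isSymm (hQ : ∀ k, t ≤ k → k < S.N → (S.Q k).IsSymm)
    (hR : ∀ k, t ≤ k → k < S.N → (S.R k).IsSymm) (hG : S.G.IsSymm) (hk : t ≤ k)
    (hkN : k < S.N) : (matW S t k).IsSymm :=
  wOf_isSymm S (hR k hk hkN) (riccatiP_isSymm S hQ hR hG (by omega) hkN)

end Riccati

/-! ### Information and square-integrable adapted vectors -/

section Info

variable {Ω : Type*}

theorem infoSigma_mono (w : ℕ → Ω → ℝ) {j k : ℕ} (h : j ≤ k) : infoSigma w j ≤ infoSigma w k :=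
  biSup_mono fun _ hl => Finset.mem_range.2 ((Finset.mem_range.1 hl).trans_le h)

theorem measurable_noise (w : ℕ → Ω → ℝ) {j k : ℕ} (h : j < k) :
    Measurable[infoSigma w k] (w j) := by
  refine Measurable.mono (comap_measurable (w j)) ?_ le_rfl
  exact le_biSup (fun l => MeasurableSpace.comap (w l) inferInstance) (Finset.mem_range.2 h)

variable [MeasurableSpace Ω] {μ : Measure Ω} {N : ℕ} {w : ℕ → Ω → ℝ}

theorem IsNoise.infoSigma_le (hw : IsNoise μ N w) {k : ℕ} (hk : k ≤ N) :
    infoSigma w k ≤ ‹MeasurableSpace Ω› :=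
  iSup₂_le fun l hl => (hw.measurable l ((Finset.mem_range.1 hl).trans_le hk)).comap_le

variable {j k p q : ℕ}

theorem IsL2At.mono {Y : Ω → Fin p → ℝ} (hY : IsL2At μ w j Y) (h : j ≤ k) : IsL2At μ w k Y :=
  ⟨hY.1.mono (infoSigma_mono w h) le_rfl, hY.2⟩

theorem IsL2At.add {Y Z : Ω → Fin p → ℝ} (hY : IsL2At μ w k Y) (hZ : IsL2At μ w k Z) :
    IsL2At μ w k fun ω => Y ω + Z ω :=
  ⟨hY.1.add hZ.1, hY.2.add hZ.2⟩

theorem IsL2At.sub {Y Z : Ω → Fin p → ℝ} (hY : IsL2At μ w k Y) (hZ : IsL2At μ w k Z) :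
    IsL2At μ w k fun ω => Y ω - Z ω :=
  ⟨hY.1.sub hZ.1, hY.2.sub hZ.2⟩

theorem IsL2At.mulVec {Y : Ω → Fin q → ℝ} (hY : IsL2At μ w k Y) (M : Matrix (Fin p) (Fin q) ℝ) :
    IsL2At μ w k fun ω => M *ᵥ Y ω :=
  ⟨(LinearMap.toContinuousLinearMap M.mulVecLin).continuous.measurable.comp hY.1,
    memLp_mulVec M hY.2⟩

theorem IsL2At.const_smul {Y : Ω → Fin p → ℝ} (hY : IsL2At μ w k Y) (c : ℝ) :
    IsL2At μ w k fun ω => c • Y ω :=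
  ⟨hY.1.const_smul c, hY.2.const_smul c⟩

theorem isL2At_const [IsFiniteMeasure μ] (c : Fin p → ℝ) : IsL2At μ w k fun _ => c :=
  ⟨measurable_const, memLp_const c⟩

theorem IsL2At.stronglyMeasurable {Y : Ω → Fin p → ℝ} (hY : IsL2At μ w k Y) :
    StronglyMeasurable[infoSigma w k] Y :=
  hY.1.stronglyMeasurable

theorem isL2At_condExp {Y : Ω → Fin p → ℝ} (hY : MemLp Y 2 μ) :
    IsL2At μ w k (μ[Y | infoSigma w k]) :=
  ⟨stronglyMeasurable_condExp.measurable, hY.condExp one_le_two⟩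

variable [IsProbabilityMeasure μ]

theorem IsL2At.noise_smul (hw : IsNoise μ N w) (hk : k < N) {Y : Ω → Fin p → ℝ}
    (hY : IsL2At μ w k Y) : IsL2At μ w (k + 1) fun ω => w k ω • Y ω :=
  ⟨(measurable_noise w k.lt_succ_self).smul (hY.mono k.le_succ).1,
    memLp_smul_of_condExp_sq_eq_one (hw.infoSigma_le hk.le) (hw.memLp k hk)
      (hw.condExp_sq_eq_one k hk) hY.1 hY.2⟩

theorem IsL2At.condExp_eq (hw : IsNoise μ N w) (hk : k ≤ N) {Y : Ω → Fin p → ℝ}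
    (hY : IsL2At μ w k Y) : μ[Y | infoSigma w k] = Y :=
  condExp_of_stronglyMeasurable (hw.infoSigma_le hk) hY.stronglyMeasurable
    (hY.2.integrable one_le_two)

end Info

/-! ### One step of the dynamics -/

section Step

variable {Ω : Type*} [MeasurableSpace Ω] {μ : Measure Ω} [IsProbabilityMeasure μ]
  {n m : ℕ} (S : LQData n m) {w : ℕ → Ω → ℝ} {t k : ℕ}

/-- The successor state `(A_k X + B_k u) + w_k (C_k X + D_k u)`. -/
def nextState (S : LQData n m) (w : ℕ → Ω → ℝ) (k : ℕ) (X : Ω → Fin n → ℝ)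
    (u : Ω → Fin m → ℝ) (ω : Ω) : Fin n → ℝ :=
  (S.A k *ᵥ X ω + S.B k *ᵥ u ω) + w k ω • (S.C k *ᵥ X ω + S.D k *ᵥ u ω)

theorem infoTime_le {d t k : ℕ} (hk : t ≤ k) : infoTime d t k ≤ k := by
  unfold infoTime
  omega

theorem isL2At_nextState (hw : IsNoise μ S.N w) (hkN : k < S.N) {X : Ω → Fin n → ℝ}
    {u : Ω → Fin m → ℝ} (hX : IsL2At μ w k X) (hu : IsL2At μ w k u) :
    IsL2At μ w (k + 1) (nextState S w k X u) :=
  (((hX.mulVec _).add (hu.mulVec _)).mono k.le_succ).add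
    (((hX.mulVec _).add (hu.mulVec _)).noise_smul hw hkN)

/-- Since u is known at time j and the noise has mean zero given the larger F_k, only the drift
survives. -/
theorem condExp_nextState (hw : IsNoise μ S.N w) (hkN : k < S.N) {j : ℕ} (hj : j ≤ k)
    {X : Ω → Fin n → ℝ} {u : Ω → Fin m → ℝ} (hX : IsL2At μ w k X) (hu : IsL2At μ w j u) :
    μ[nextState S w k X u | infoSigma w j]
      =ᵐ[μ] fun ω => S.A k *ᵥ (μ[X | infoSigma w j]) ω + S.B k *ᵥ u ω := by
  have huk := hu.mono hj
  have hAX := hX.mulVec (S.A k)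
  have hBu := hu.mulVec (S.B k)
  have hCD := (hX.mulVec (S.C k)).add (huk.mulVec (S.D k))
  have hint : ∀ {l p : ℕ} {Y : Ω → Fin p → ℝ}, IsL2At μ w l Y → Integrable Y μ :=
    fun hY => hY.2.integrable one_le_two
  have e0 : μ[nextState S w k X u | infoSigma w j]
      =ᵐ[μ] μ[fun ω => S.A k *ᵥ X ω + S.B k *ᵥ u ω | infoSigma w j]
        + μ[fun ω => w k ω • (S.C k *ᵥ X ω + S.D k *ᵥ u ω) | infoSigma w j] :=
    condExp_add (hint (hAX.add (hBu.mono hj))) (hint (hCD.noise_smul hw hkN)) _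
  have e1 : μ[fun ω => S.A k *ᵥ X ω + S.B k *ᵥ u ω | infoSigma w j]
      =ᵐ[μ] μ[fun ω => S.A k *ᵥ X ω | infoSigma w j]
        + μ[fun ω => S.B k *ᵥ u ω | infoSigma w j] :=
    condExp_add (hint hAX) (hint hBu) _
  have e2 := condExp_mulVec (m₀ := infoSigma w j) (S.A k) (hint hX)
  have e3 := hBu.condExp_eq hw (hj.trans hkN.le)
  have e4 := condExp_smul_noise_eq_zero (hw.infoSigma_le hkN.le) (infoSigma_mono w hj)
    (hw.memLp k hkN) (hw.condExp_eq_zero k hkN) (hw.condExp_sq_eq_one k hkN) hCD.1 hCD.2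
  filter_upwards [e0, e1, e2, e4] with ω h0 h1 h2 h4
  rw [h0, Pi.add_apply, h1, Pi.add_apply, h2, h4, e3, add_zero]

/-- The quadratic functional `∑ i, E[(E_{k-i} X)ᵀ P^{(i)}_k (E_{k-i} X)]`. -/
def value (μ : Measure Ω) (S : LQData n m) (w : ℕ → Ω → ℝ) (t k : ℕ) (X : Ω → Fin n → ℝ) : ℝ :=
  ∑ i ∈ Finset.range (S.d + 1), bilinExp μ (riccatiP S t k i)
    (μ[X | infoSigma w (max t (k - i))]) (μ[X | infoSigma w (max t (k - i))])

theorem value_terminal (hw : IsNoise μ S.N w) (ht : t ≤ S.N) {X : Ω → Fin n → ℝ}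
    (hX : IsL2At μ w S.N X) : value μ S w t S.N X = bilinExp μ S.G X X := by
  rw [value, Finset.sum_eq_single 0]
  · rw [riccatiP_terminal]
    simp only [if_true]
    rw [Nat.sub_zero, max_eq_right ht, hX.condExp_eq hw le_rfl]
  · intro i _ hi
    rw [riccatiP_terminal]
    simp only [hi, if_false]
    exact bilinExp_zero_matrix _ _
  · simp

/-- Expresses V_k through P_{k+1}, ready for comparison with `value_nextState`. The P^{(1)} part of
`baseTerm` becomes the summand i = 0 of the shifted sum, because E_k X = X. -/
theorem value_eq (hd : 2 ≤ S.d) (hw : IsNoise μ S.N w) (hk : t ≤ k) (hkN : k < S.N)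
    {X : Ω → Fin n → ℝ} (hX : IsL2At μ w k X) :
    value μ S w t k X = bilinExp μ (S.Q k) X X
      + bilinExp μ ((S.A k)ᵀ * riccatiP S t (k + 1) 0 * S.A k) X X
      + bilinExp μ ((S.C k)ᵀ * riccatiP S t (k + 1) 0 * S.C k) X X
      + ∑ i ∈ Finset.range S.d, bilinExp μ ((S.A k)ᵀ * riccatiP S t (k + 1) (i + 1) * S.A k)
          (μ[X | infoSigma w (max t (k - i))]) (μ[X | infoSigma w (max t (k - i))])
      - bilinExp μ (corrTerm S t k (riccatiP S t (k + 1))) (delayedExp μ w S.d t k X)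
          (delayedExp μ w S.d t k X) := by
  have hE : ∀ i, MemLp (μ[X | infoSigma w (max t (k - i))]) 2 μ := fun i =>
    (isL2At_condExp hX.2).2
  have h0 : μ[X | infoSigma w (max t (k - 0))] = X := by
    rw [Nat.sub_zero, max_eq_right hk, hX.condExp_eq hw hkN.le]
  have hcorr : ∑ i ∈ Finset.range (S.d + 1), bilinExp μ
      (if min S.d (k - t) = i then corrTerm S t k (riccatiP S t (k + 1)) else 0)
        (μ[X | infoSigma w (max t (k - i))]) (μ[X | infoSigma w (max t (k - i))])
      = bilinExp μ (corrTerm S t k (riccatiP S t (k + 1))) (delayedExp μ w S.d t k X)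
          (delayedExp μ w S.d t k X) := by
    rw [Finset.sum_eq_single (min S.d (k - t))]
    · rw [if_pos rfl, show max t (k - min S.d (k - t)) = infoTime S.d t k by
        unfold infoTime; omega]
      rfl
    · intro i _ hi
      rw [if_neg hi.symm, bilinExp_zero_matrix]
    · intro h
      exact absurd (Finset.mem_range.2 (by omega)) h
  -- Shifting lag d would call for P^{(d+1)}; its vanishing stops the shifted sum at i < d.
  have hlast : riccatiP S t (k + 1) (S.d + 1) = 0 :=
    riccatiP_eq_zero S hd (by omega) hkN (by omega)
  simp only [value, riccatiP_eq S hd hk hkN, bilinExp_sub_matrix _ _ (hE _) (hE _),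
    Finset.sum_sub_distrib, hcorr]
  congr 1
  obtain ⟨d, hd'⟩ : ∃ d, S.d = d + 1 := ⟨S.d - 1, by omega⟩
  rw [Finset.sum_range_succ', hd', Finset.sum_range_succ, Finset.sum_range_succ']
  simp only [Nat.add_eq_zero_iff, one_ne_zero, and_false, if_false, if_true, ← hd', hlast]
  rw [h0, baseTerm, bilinExp_add_matrix _ _ hX.2 hX.2, bilinExp_add_matrix _ _ hX.2 hX.2,
    Matrix.mul_add, Matrix.add_mul, bilinExp_add_matrix _ _ hX.2 hX.2]
  simp only [if_neg (show S.d ≠ 0 by omega), Matrix.mul_zero, Matrix.zero_mul,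
    bilinExp_zero_matrix, zero_add]
  ring

/-- Lag 0 sees the noise and splits into drift and diffusion parts. Lag i + 1 conditions at time k -
i and sees only the drift; in its cross term E_{k-i}X may be replaced by X since u is known then. -/
theorem value_nextState (hw : IsNoise μ S.N w) (hk : t ≤ k) (hkN : k < S.N)
    (hP : ∀ i, (riccatiP S t (k + 1) i).IsSymm) {X : Ω → Fin n → ℝ} {u : Ω → Fin m → ℝ}
    (hX : IsL2At μ w k X) (hu : IsL2At μ w (infoTime S.d t k) u) :
    value μ S w t (k + 1) (nextState S w k X u) =
      bilinExp μ (riccatiP S t (k + 1) 0) (fun ω => S.A k *ᵥ X ω + S.B k *ᵥ u ω)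
          (fun ω => S.A k *ᵥ X ω + S.B k *ᵥ u ω)
        + bilinExp μ (riccatiP S t (k + 1) 0) (fun ω => S.C k *ᵥ X ω + S.D k *ᵥ u ω)
          (fun ω => S.C k *ᵥ X ω + S.D k *ᵥ u ω)
        + ∑ i ∈ Finset.range S.d,
          (bilinExp μ ((S.A k)ᵀ * riccatiP S t (k + 1) (i + 1) * S.A k)
              (μ[X | infoSigma w (max t (k - i))]) (μ[X | infoSigma w (max t (k - i))])
            + 2 * bilinExp μ ((S.B k)ᵀ * riccatiP S t (k + 1) (i + 1) * S.A k) u X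
            + bilinExp μ ((S.B k)ᵀ * riccatiP S t (k + 1) (i + 1) * S.B k) u u) := by
  have huk := hu.mono (infoTime_le hk)
  have hX' := isL2At_nextState S hw hkN hX huk
  have hAB := (hX.mulVec (S.A k)).add (huk.mulVec (S.B k))
  have hCD := (hX.mulVec (S.C k)).add (huk.mulVec (S.D k))
  rw [value, Finset.sum_range_succ', add_comm, Nat.sub_zero, max_eq_right (by omega),
    hX'.condExp_eq hw hkN]
  congr 1
  · exact bilinExp_add_noise (hw.infoSigma_le hkN.le) (hw.memLp k hkN) (hw.condExp_eq_zero k hkN)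
      (hw.condExp_sq_eq_one k hkN) _ hAB.1 hCD.1 hAB.2 hCD.2
  · refine Finset.sum_congr rfl fun i hi => ?_
    rw [Finset.mem_range] at hi
    rw [Nat.add_sub_add_right]
    have hj : max t (k - i) ≤ k := by omega
    -- Here the delay structure enters: for i < d the conditioning time is no earlier than the
    -- controller's information time.
    have huj : IsL2At μ w (max t (k - i)) u := hu.mono (by unfold infoTime; omega)
    have he := condExp_nextState S hw hkN hj hX huj
    rw [bilinExp_congr _ he he, bilinExp_affine (hP (i + 1)) _ _ (isL2At_condExp hX.2).2 hu.2,
      bilinExp_condExp_right (hw.infoSigma_le (hj.trans hkN.le)) _ huj.stronglyMeasurable huj.2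
        hX.2]

/-- The terms quadratic in X cancel by the Riccati-like equations, except the correction; the terms
containing u assemble into W_k and H_k. As u is known at the information time, E_{k-d}X and X are
interchangeable in the cross term. -/
theorem stage_add_value_nextState (hd : 2 ≤ S.d) (hw : IsNoise μ S.N w) (hk : t ≤ k)
    (hkN : k < S.N) (hP : ∀ i, (riccatiP S t (k + 1) i).IsSymm) {X : Ω → Fin n → ℝ}
    {u : Ω → Fin m → ℝ} (hX : IsL2At μ w k X) (hu : IsL2At μ w (infoTime S.d t k) u) :
    bilinExp μ (S.Q k) X X + bilinExp μ (S.R k) u u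
        + value μ S w t (k + 1) (nextState S w k X u)
      = value μ S w t k X
        + (bilinExp μ (matW S t k) u u + 2 * bilinExp μ (matH S t k) u (delayedExp μ w S.d t k X)
          + bilinExp μ ((matH S t k)ᵀ * pinv (matW S t k) * matH S t k)
            (delayedExp μ w S.d t k X) (delayedExp μ w S.d t k X)) := by
  have hkI : infoTime S.d t k ≤ S.N := (infoTime_le hk).trans hkN.le
  rw [value_nextState S hw hk hkN hP hX hu, value_eq S hd hw hk hkN hX, delayedExp,
    bilinExp_condExp_right (hw.infoSigma_le hkI) _ hu.stronglyMeasurable hu.2 hX.2,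
    bilinExp_affine (hP 0) _ _ hX.2 hu.2, bilinExp_affine (hP 0) _ _ hX.2 hu.2]
  rw [show corrTerm S t k (riccatiP S t (k + 1))
    = (matH S t k)ᵀ * pinv (matW S t k) * matH S t k from rfl]
  rw [show bilinExp μ (matW S t k) u u = _ from congrArg (bilinExp μ · u u) (matW_eq S hd hk hkN),
    show bilinExp μ (matH S t k) u X = _ from congrArg (bilinExp μ · u X) (matH_eq S hd hk hkN)]
  simp only [bilinExp_add_matrix _ _ hu.2 hu.2, bilinExp_add_matrix _ _ hu.2 hX.2,
    bilinExp_sum_matrix _ _ hu.2 hu.2, bilinExp_sum_matrix _ _ hu.2 hX.2,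
    Finset.sum_range_succ', Finset.sum_add_distrib, ← Finset.mul_sum]
  ring

end Step

/-! ### Representation of the cost -/

section Cost

variable {Ω : Type*} {n m : ℕ} (S : LQData n m) {w : ℕ → Ω → ℝ} {t : ℕ} {x : Ω → Fin n → ℝ}

theorem state_succ {k : ℕ} (hk : t ≤ k) (u : ℕ → Ω → Fin m → ℝ) :
    state S w t x u (k + 1) = nextState S w k (state S w t x u k) (u k) := by
  rw [state, if_pos hk]
  rfl

theorem state_of_le {k : ℕ} (hk : k ≤ t) (u : ℕ → Ω → Fin m → ℝ) : state S w t x u k = x := by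
  cases k with
  | zero => rfl
  | succ k => rw [state, if_neg (by omega)]

variable [MeasurableSpace Ω] {μ : Measure Ω}

/-- The control `g_k - W_k† H_k E_{k-d} X^{x,g}_k`, whose state is the shifted closed-loop state
`X^{x,g}`. -/
def shiftedControl (μ : Measure Ω) (S : LQData n m) (w : ℕ → Ω → ℝ) (t : ℕ) (x : Ω → Fin n → ℝ)
    (g : ℕ → Ω → Fin m → ℝ) (k : ℕ) (ω : Ω) : Fin m → ℝ :=
  g k ω - (pinv (matW S t k) * matH S t k) *ᵥ
    delayedExp μ w S.d t k (shiftedState μ S w t x g k) ω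

theorem state_shiftedControl (g : ℕ → Ω → Fin m → ℝ) (k : ℕ) :
    state S w t x (shiftedControl μ S w t x g) k = shiftedState μ S w t x g k := by
  induction k with
  | zero => rfl
  | succ k ih =>
    rw [state, shiftedState]
    split_ifs with hk
    · funext ω
      simp only [ih, shiftedControl, mulVec_sub, mulVec_mulVec, ← Matrix.mul_assoc]
      congr 1
      · abel
      · congr 1
        abel
    · rfl

/-- Causality: a perturbation of the control at time k leaves the states up to k unchanged. -/
theorem shiftedState_congr {g g' : ℕ → Ω → Fin m → ℝ} {k : ℕ} (h : ∀ j < k, g j = g' j) :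
    shiftedState μ S w t x g k = shiftedState μ S w t x g' k := by
  induction k with
  | zero => rfl
  | succ k ih =>
    rw [shiftedState, shiftedState, ih fun j hj => h j (by omega), h k (by omega)]

theorem feedback_eq_shiftedControl :
    feedback μ S w t x = shiftedControl μ S w t x fun _ _ => 0 := by
  funext k ω
  rw [shiftedControl, zero_sub]
  rfl

theorem isL2At_delayedExp {k : ℕ} {Y : Ω → Fin n → ℝ} (hY : MemLp Y 2 μ) :
    IsL2At μ w (infoTime S.d t k) (delayedExp μ w S.d t k Y) :=
  isL2At_condExp hY

/-- Completion of the square, without any range condition. -/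
theorem bilinExp_complete_square {W : Matrix (Fin m) (Fin m) ℝ} (hW : W.IsSymm)
    (H : Matrix (Fin m) (Fin n) ℝ) {g : Ω → Fin m → ℝ} {Y : Ω → Fin n → ℝ}
    (hg : MemLp g 2 μ) (hY : MemLp Y 2 μ) :
    bilinExp μ W (fun ω => g ω - (pinv W * H) *ᵥ Y ω) (fun ω => g ω - (pinv W * H) *ᵥ Y ω)
        + 2 * bilinExp μ H (fun ω => g ω - (pinv W * H) *ᵥ Y ω) Y
        + bilinExp μ (Hᵀ * pinv W * H) Y Y
      = bilinExp μ W g g + 2 * bilinExp μ (H - W * pinv W * H) g Y := by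
  -- Puts the control in the affine form required by `bilinExp_affine`, with coefficients -W†H and
  -- 1.
  have hv : (fun ω => g ω - (pinv W * H) *ᵥ Y ω)
      = fun ω => (-(pinv W * H)) *ᵥ Y ω + (1 : Matrix (Fin m) (Fin m) ℝ) *ᵥ g ω := by
    funext ω
    rw [one_mulVec, neg_mulVec]
    abel
  have hpW := pinv_isSymm hW
  have e1 : (-(pinv W * H))ᵀ * W * -(pinv W * H) = Hᵀ * pinv W * H := by
    have h := (pinv_spec W).self_mul_mul
    calc (-(pinv W * H))ᵀ * W * -(pinv W * H) = Hᵀ * (pinv W * W * pinv W) * H := by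
          simp only [transpose_neg, transpose_mul, hpW.eq, Matrix.neg_mul, Matrix.mul_neg, neg_neg,
            Matrix.mul_assoc]
      _ = _ := by rw [h]
  have e2 : bilinExp μ H (fun ω => (-(pinv W * H)) *ᵥ Y ω
      + (1 : Matrix (Fin m) (Fin m) ℝ) *ᵥ g ω) Y
      = - bilinExp μ (Hᵀ * pinv W * H) Y Y + bilinExp μ H g Y := by
    rw [bilinExp_add_left _ (memLp_mulVec _ hY) (memLp_mulVec _ hg) hY]
    have h := bilinExp_mulVec_mulVec (μ := μ) H (-(pinv W * H)) 1 Y Y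
    simp only [one_mulVec, Matrix.mul_one, transpose_neg, transpose_mul, hpW.eq, Matrix.neg_mul,
      bilinExp_neg_matrix] at h ⊢
    rw [h]
  rw [hv, bilinExp_affine hW _ _ hY hg, e1, e2, bilinExp_sub_matrix _ _ hg hY]
  simp only [transpose_one, Matrix.one_mul, Matrix.mul_one, Matrix.mul_neg, bilinExp_neg_matrix,
    Matrix.mul_assoc]
  ring

/-- `(1 - W_k W_k†) H_k`. -/
def residual (S : LQData n m) (t k : ℕ) : Matrix (Fin m) (Fin n) ℝ :=
  matH S t k - matW S t k * pinv (matW S t k) * matH S t k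

theorem matH_mulVec_mem_range_iff {k : ℕ} (y : Fin n → ℝ) :
    matH S t k *ᵥ y ∈ LinearMap.range (matW S t k).mulVecLin ↔ residual S t k *ᵥ y = 0 := by
  rw [mem_range_mulVecLin_iff, residual, sub_mulVec, sub_eq_zero, mulVec_mulVec, eq_comm]

variable [IsProbabilityMeasure μ]

theorem isL2At_state (hw : IsNoise μ S.N w) (hx : IsL2At μ w t x) {u : ℕ → Ω → Fin m → ℝ}
    (hu : IsAdmissible μ S w t u) {k : ℕ} (hk : t ≤ k) (hkN : k ≤ S.N) :
    IsL2At μ w k (state S w t x u k) := by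
  induction k, hk using Nat.le_induction with
  | base => rwa [state_of_le S le_rfl]
  | succ k hk ih =>
    rw [state_succ S hk]
    exact isL2At_nextState S hw hkN (ih (by omega)) ((hu k hk hkN).mono (infoTime_le hk))

theorem isL2At_shiftedState (hw : IsNoise μ S.N w) (hx : IsL2At μ w t x)
    {g : ℕ → Ω → Fin m → ℝ} (hg : IsAdmissible μ S w t g) {k : ℕ} (hk : t ≤ k)
    (hkN : k ≤ S.N) : IsL2At μ w k (shiftedState μ S w t x g k) := by
  induction k, hk using Nat.le_induction with
  | base => rwa [← state_shiftedControl, state_of_le S le_rfl]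
  | succ k hk ih =>
    have hX := ih (by omega)
    rw [← state_shiftedControl, state_succ S hk, state_shiftedControl]
    exact isL2At_nextState S hw hkN hX
      (((hg k hk hkN).sub ((isL2At_delayedExp S hX.2).mulVec _)).mono (infoTime_le hk))

theorem IsAdmissible.shiftedControl (hw : IsNoise μ S.N w) (hx : IsL2At μ w t x)
    {g : ℕ → Ω → Fin m → ℝ} (hg : IsAdmissible μ S w t g) :
    IsAdmissible μ S w t (shiftedControl μ S w t x g) := fun k hk hkN =>
  (hg k hk hkN).sub
    ((isL2At_delayedExp S (isL2At_shiftedState S hw hx hg hk hkN.le).2).mulVec _)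

/-- Every admissible control is a feedback plus an admissible perturbation. -/
theorem exists_shiftedControl_eq (hw : IsNoise μ S.N w) (hx : IsL2At μ w t x)
    {v : ℕ → Ω → Fin m → ℝ} (hv : IsAdmissible μ S w t v) :
    ∃ g, IsAdmissible μ S w t g ∧ shiftedControl μ S w t x g = v := by
  -- The feedback is added back along the state of v itself, so g is explicit; `hs` shows that this
  -- state is the shifted state of g.
  let g : ℕ → Ω → Fin m → ℝ := fun k ω => v k ω + (pinv (matW S t k) * matH S t k) *ᵥ
    delayedExp μ w S.d t k (state S w t x v k) ω
  have hs : ∀ k, shiftedState μ S w t x g k = state S w t x v k := by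
    intro k
    induction k with
    | zero => rfl
    | succ k ih =>
      rw [state, shiftedState]
      split_ifs with hk
      · funext ω
        simp only [ih, g, mulVec_add, mulVec_mulVec, ← Matrix.mul_assoc]
        congr 1
        · abel
        · congr 1
          abel
      · rfl
  refine ⟨g, fun k hk hkN => (hv k hk hkN).add
    ((isL2At_delayedExp S (isL2At_state S hw hx hv hk hkN.le).2).mulVec _), ?_⟩
  funext k ω
  simp only [DelayedLQ.shiftedControl, hs, g, add_sub_cancel_right]

theorem cost_eq (hd : 2 ≤ S.d) (hw : IsNoise μ S.N w) (ht : t < S.N)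
    (hQ : ∀ k, t ≤ k → k < S.N → (S.Q k).IsSymm)
    (hR : ∀ k, t ≤ k → k < S.N → (S.R k).IsSymm) (hG : S.G.IsSymm)
    (hx : IsL2At μ w t x) {u : ℕ → Ω → Fin m → ℝ} (hu : IsAdmissible μ S w t u) :
    cost μ S w t x u = value μ S w t t x + ∑ k ∈ Finset.Ico t S.N,
      (bilinExp μ (matW S t k) (u k) (u k)
        + 2 * bilinExp μ (matH S t k) (u k) (delayedExp μ w S.d t k (state S w t x u k))
        + bilinExp μ ((matH S t k)ᵀ * pinv (matW S t k) * matH S t k)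
            (delayedExp μ w S.d t k (state S w t x u k))
            (delayedExp μ w S.d t k (state S w t x u k))) := by
  -- Telescoping over a truncated horizon K; at K = t both sums are empty.
  have key : ∀ K, t ≤ K → K ≤ S.N →
      (∑ k ∈ Finset.Ico t K, (bilinExp μ (S.Q k) (state S w t x u k) (state S w t x u k)
        + bilinExp μ (S.R k) (u k) (u k))) + value μ S w t K (state S w t x u K)
      = value μ S w t t x + ∑ k ∈ Finset.Ico t K,
      (bilinExp μ (matW S t k) (u k) (u k)
        + 2 * bilinExp μ (matH S t k) (u k) (delayedExp μ w S.d t k (state S w t x u k))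
        + bilinExp μ ((matH S t k)ᵀ * pinv (matW S t k) * matH S t k)
            (delayedExp μ w S.d t k (state S w t x u k))
            (delayedExp μ w S.d t k (state S w t x u k))) := by
    intro K hK hKN
    induction K, hK using Nat.le_induction with
    | base => simp [state_of_le S le_rfl]
    | succ k hk ih =>
      have hX := isL2At_state S hw hx hu hk (by omega : k ≤ S.N)
      have hstep := stage_add_value_nextState S hd hw hk hKN
        (riccatiP_isSymm S hQ hR hG (by omega) hKN) hX (hu k hk hKN)
      rw [Finset.sum_Ico_succ_top hk, Finset.sum_Ico_succ_top hk, state_succ S hk, add_assoc,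
        hstep, ← add_assoc, ih (by omega), add_assoc]
  rw [← key S.N ht.le le_rfl, value_terminal S hw ht.le (isL2At_state S hw hx hu ht.le le_rfl),
    cost]
  congr 1
  refine Finset.sum_congr rfl fun k hk => ?_
  rw [Finset.mem_Ico] at hk
  have hX := (isL2At_state S hw hx hu hk.1 hk.2.le).2
  have huk := (hu k hk.1 hk.2).2
  exact integral_add (integrable_bilin _ hX hX) (integrable_bilin _ huk huk)

/-- Every summand contains the factor g_k, so it vanishes with g_k even when the state depends on
earlier perturbations. Neither positivity nor the range condition is needed. -/
theorem cost_shiftedControl (hd : 2 ≤ S.d) (hw : IsNoise μ S.N w) (ht : t < S.N)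
    (hQ : ∀ k, t ≤ k → k < S.N → (S.Q k).IsSymm)
    (hR : ∀ k, t ≤ k → k < S.N → (S.R k).IsSymm) (hG : S.G.IsSymm)
    (hx : IsL2At μ w t x) {g : ℕ → Ω → Fin m → ℝ} (hg : IsAdmissible μ S w t g) :
    cost μ S w t x (shiftedControl μ S w t x g) = value μ S w t t x + ∑ k ∈ Finset.Ico t S.N,
      (bilinExp μ (matW S t k) (g k) (g k) + 2 * bilinExp μ (residual S t k) (g k)
        (delayedExp μ w S.d t k (shiftedState μ S w t x g k))) := by
  rw [cost_eq S hd hw ht hQ hR hG hx (hg.shiftedControl S hw hx)]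
  congr 1
  refine Finset.sum_congr rfl fun k hk => ?_
  rw [Finset.mem_Ico] at hk
  rw [state_shiftedControl]
  exact bilinExp_complete_square (matW_isSymm S hQ hR hG hk.1 hk.2) _ (hg k hk.1 hk.2).2
    (isL2At_delayedExp S (isL2At_shiftedState S hw hx hg hk.1 hk.2.le).2).2

end Cost

/-! ### Perturbations and necessity -/

section Necessity

theorem nonneg_and_eq_zero_of_bddBelow {a b c : ℝ} (h : ∀ s : ℝ, c ≤ s ^ 2 * a + s * b) :
    0 ≤ a ∧ (a = 0 → b = 0) := by
  constructor
  · by_contra! ha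
    -- Averaging the bounds at s and -s removes the linear term.
    have h2 : ∀ s : ℝ, c ≤ s ^ 2 * a := fun s => by
      have h1 := h s
      have h3 := h (-s)
      nlinarith
    have hs : 0 ≤ (|c| + 1) / -a := div_nonneg (by positivity) (by linarith)
    -- At this s ≥ 1 one has s²a ≤ sa < -(|c| + 1) < c, a contradiction.
    have h3 := h2 ((|c| + 1) / -a + 1)
    have h4 : (|c| + 1) / -a * a = -(|c| + 1) := by
      rw [div_neg, neg_mul, div_mul_cancel₀ _ ha.ne]
    have h5 := neg_abs_le c
    nlinarith [mul_nonneg hs hs, mul_nonneg (mul_nonneg hs hs) (neg_nonneg.2 ha.le)]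
  · rintro rfl
    by_contra hb
    have h1 := h ((c - 1) / b)
    rw [div_mul_cancel₀ _ hb] at h1
    linarith

variable {Ω : Type*} [MeasurableSpace Ω] {μ : Measure Ω} [IsProbabilityMeasure μ]
  {n m : ℕ} (S : LQData n m) {w : ℕ → Ω → ℝ} {t : ℕ} {x : Ω → Fin n → ℝ}

/-- If the cost is bounded below, so is its second variation at time `k` along the control that
follows `u` before `k` and the feedback after `k`. -/
theorem exists_le_of_isSolvable (hd : 2 ≤ S.d) (hw : IsNoise μ S.N w) (ht : t < S.N)
    (hQ : ∀ k, t ≤ k → k < S.N → (S.Q k).IsSymm)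
    (hR : ∀ k, t ≤ k → k < S.N → (S.R k).IsSymm) (hG : S.G.IsSymm)
    (hx : IsL2At μ w t x) (hsol : IsSolvable μ S w t x) {u : ℕ → Ω → Fin m → ℝ}
    (hu : IsAdmissible μ S w t u) {k : ℕ} (hk : t ≤ k) (hkN : k < S.N) {e : Ω → Fin m → ℝ}
    (he : IsL2At μ w (infoTime S.d t k) e) :
    ∃ c : ℝ, ∀ s : ℝ, c ≤ s ^ 2 * bilinExp μ (matW S t k) e e
      + s * (2 * bilinExp μ (residual S t k) e
          (delayedExp μ w S.d t k (shiftedState μ S w t x u k))) := by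
  obtain ⟨ubar, -, hopt⟩ := hsol
  let term : (ℕ → Ω → Fin m → ℝ) → ℕ → ℝ := fun g j => bilinExp μ (matW S t j) (g j) (g j)
    + 2 * bilinExp μ (residual S t j) (g j)
      (delayedExp μ w S.d t j (shiftedState μ S w t x g j))
  -- With g = 0 after k the later summands vanish, although the later states depend on s. So s
  -- enters only the summand at k.
  let g : ℝ → ℕ → Ω → Fin m → ℝ := fun s j =>
    if j < k then u j else if k = j then (fun ω => s • e ω) else fun _ => 0
  have hg : ∀ s, IsAdmissible μ S w t (g s) := by
    intro s j hj hjN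
    dsimp only [g]
    split_ifs with h1 h2
    · exact hu j hj hjN
    · subst h2
      exact he.const_smul s
    · exact isL2At_const 0
  have hgu : ∀ s j, j ≤ k → shiftedState μ S w t x (g s) j = shiftedState μ S w t x u j :=
    fun s j hj => shiftedState_congr S fun i hi => if_pos (by omega)
  have hterm : ∀ s j, term (g s) j = (if j < k then term u j else 0)
      + (if k = j then s ^ 2 * bilinExp μ (matW S t k) e e
      + s * (2 * bilinExp μ (residual S t k) e
          (delayedExp μ w S.d t k (shiftedState μ S w t x u k))) else 0) := by
    intro s j
    rcases lt_trichotomy j k with h | rfl | h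
    · have hgj : g s j = u j := if_pos h
      rw [if_pos h, if_neg (by omega), add_zero]
      simp only [term, hgj, hgu s j h.le]
    · have hgj : g s j = fun ω => s • e ω := by simp [g]
      rw [if_neg (lt_irrefl j), if_pos rfl, zero_add]
      simp only [term, hgj, hgu s j le_rfl]
      simp only [bilinExp, smul_dotProduct, mulVec_smul, dotProduct_smul, smul_eq_mul,
        integral_const_mul]
      ring
    · have hgj : g s j = fun _ => 0 := by
        dsimp only [g]
        rw [if_neg (by omega), if_neg (by omega)]
      rw [if_neg (by omega), if_neg (by omega)]
      simp [term, hgj, bilinExp]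
  refine ⟨cost μ S w t x ubar - value μ S w t t x
    - ∑ j ∈ Finset.Ico t S.N, if j < k then term u j else 0, fun s => ?_⟩
  -- Solvability is used only through the lower bound on the cost.
  have h := hopt _ ((hg s).shiftedControl S hw hx)
  rw [cost_shiftedControl S hd hw ht hQ hR hG hx (hg s),
    Finset.sum_congr rfl fun j _ => hterm s j, Finset.sum_add_distrib, Finset.sum_ite_eq,
    if_pos (Finset.mem_Ico.2 ⟨hk, hkN⟩)] at h
  linarith

theorem posSemidef_matW_of_isSolvable (hd : 2 ≤ S.d) (hw : IsNoise μ S.N w) (ht : t < S.N)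
    (hQ : ∀ k, t ≤ k → k < S.N → (S.Q k).IsSymm)
    (hR : ∀ k, t ≤ k → k < S.N → (S.R k).IsSymm) (hG : S.G.IsSymm)
    (hx : IsL2At μ w t x) (hsol : IsSolvable μ S w t x) {k : ℕ} (hk : t ≤ k) (hkN : k < S.N) :
    (matW S t k).PosSemidef := by
  refine .of_dotProduct_mulVec_nonneg ?_ fun y => ?_
  · rw [Matrix.IsHermitian, conjTranspose_eq_transpose_of_trivial]
    exact matW_isSymm S hQ hR hG hk hkN
  · obtain ⟨c, hc⟩ := exists_le_of_isSolvable S hd hw ht hQ hR hG hx hsol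
      -- A constant direction y is measurable with respect to any information, and its quadratic
      -- coefficient is yᵀW_k y.
      (u := fun _ _ => 0) (fun _ _ _ => isL2At_const 0) hk hkN (e := fun _ => y) (isL2At_const y)
    have h := (nonneg_and_eq_zero_of_bddBelow hc).1
    simpa [bilinExp] using h

/-- The perturbation direction is the residual vector itself. It is known at the information time
and annihilated by W_k, so boundedness below forces its second moment to vanish. -/
theorem mem_range_of_isSolvable (hd : 2 ≤ S.d) (hw : IsNoise μ S.N w) (ht : t < S.N)
    (hQ : ∀ k, t ≤ k → k < S.N → (S.Q k).IsSymm)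
    (hR : ∀ k, t ≤ k → k < S.N → (S.R k).IsSymm) (hG : S.G.IsSymm)
    (hx : IsL2At μ w t x) (hsol : IsSolvable μ S w t x) {u : ℕ → Ω → Fin m → ℝ}
    (hu : IsAdmissible μ S w t u) {k : ℕ} (hk : t ≤ k) (hkN : k < S.N) :
    ∀ᵐ ω ∂μ, matH S t k *ᵥ delayedExp μ w S.d t k (shiftedState μ S w t x u k) ω
      ∈ LinearMap.range (matW S t k).mulVecLin := by
  have hY : IsL2At μ w (infoTime S.d t k)
      (delayedExp μ w S.d t k (shiftedState μ S w t x u k)) :=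
    isL2At_delayedExp S (isL2At_shiftedState S hw hx hu hk hkN.le).2
  have he := hY.mulVec (residual S t k)
  have hWres : matW S t k * residual S t k = 0 := by
    have hsymm := matW_isSymm S hQ hR hG hk hkN
    -- Transposing WW†W = W, with W and WW† symmetric, gives W(WW†) = W.
    have h1 : matW S t k * (matW S t k * pinv (matW S t k)) = matW S t k := by
      have h2 := congrArg transpose (pinv_spec (matW S t k)).mul_mul_self
      rwa [transpose_mul, (pinv_spec (matW S t k)).symm_left, hsymm.eq] at h2
    rw [residual, Matrix.mul_sub, ← Matrix.mul_assoc, h1, sub_self]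
  obtain ⟨c, hc⟩ := exists_le_of_isSolvable S hd hw ht hQ hR hG hx hsol hu hk hkN he
  have h0 := (nonneg_and_eq_zero_of_bddBelow hc).2
    (by simp [bilinExp, mulVec_mulVec, hWres])
  have hint : ∫ ω, residual S t k *ᵥ delayedExp μ w S.d t k (shiftedState μ S w t x u k) ω ⬝ᵥ
      residual S t k *ᵥ delayedExp μ w S.d t k (shiftedState μ S w t x u k) ω ∂μ = 0 := by
    simpa [bilinExp] using h0
  have hnn : ∀ y : Fin m → ℝ, 0 ≤ y ⬝ᵥ y := fun y =>
    Finset.sum_nonneg fun i _ => mul_self_nonneg (y i)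
  rw [integral_eq_zero_iff_of_nonneg (fun ω => hnn _) (integrable_dotProduct he.2 he.2)] at hint
  filter_upwards [hint] with ω hω
  rw [matH_mulVec_mem_range_iff]
  exact dotProduct_self_eq_zero.1 hω

end Necessity

/-! ### Sufficiency -/

theorem isOptimalControl_feedback {Ω : Type*} [MeasurableSpace Ω] {μ : Measure Ω}
    [IsProbabilityMeasure μ] {n m : ℕ} (S : LQData n m) {w : ℕ → Ω → ℝ} {t : ℕ}
    {x : Ω → Fin n → ℝ} (hd : 2 ≤ S.d) (hw : IsNoise μ S.N w) (ht : t < S.N)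
    (hQ : ∀ k, t ≤ k → k < S.N → (S.Q k).IsSymm)
    (hR : ∀ k, t ≤ k → k < S.N → (S.R k).IsSymm) (hG : S.G.IsSymm)
    (hx : IsL2At μ w t x) (hW : ∀ k, t ≤ k → k < S.N → (matW S t k).PosSemidef)
    (hran : ∀ u, IsAdmissible μ S w t u → ∀ k, t ≤ k → k < S.N →
      ∀ᵐ ω ∂μ, matH S t k *ᵥ delayedExp μ w S.d t k (shiftedState μ S w t x u k) ω
        ∈ LinearMap.range (matW S t k).mulVecLin) :
    IsOptimalControl μ S w t x (feedback μ S w t x) := by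
  have h0 : IsAdmissible μ S w t (fun _ _ => 0 : ℕ → Ω → Fin m → ℝ) :=
    fun _ _ _ => isL2At_const 0
  rw [feedback_eq_shiftedControl]
  refine ⟨h0.shiftedControl S hw hx, fun v hv => ?_⟩
  obtain ⟨g, hg, rfl⟩ := exists_shiftedControl_eq S hw hx hv
  rw [cost_shiftedControl S hd hw ht hQ hR hG hx h0, cost_shiftedControl S hd hw ht hQ hR hG hx hg]
  refine add_le_add le_rfl (Finset.sum_le_sum fun k hk => ?_)
  rw [Finset.mem_Ico] at hk
  have hres : bilinExp μ (residual S t k) (g k)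
      (delayedExp μ w S.d t k (shiftedState μ S w t x g k)) = 0 := by
    refine integral_eq_zero_of_ae ?_
    filter_upwards [hran g hg k hk.1 hk.2] with ω hω
    rw [(matH_mulVec_mem_range_iff S _).1 hω, dotProduct_zero]
    rfl
  have hnn : 0 ≤ bilinExp μ (matW S t k) (g k) (g k) :=
    integral_nonneg fun ω => by simpa using (hW k hk.1 hk.2).dotProduct_mulVec_nonneg (g k ω)
  -- Only the quadratic term of g remains; on the feedback side g = 0 and the whole summand is zero.
  rw [hres, mul_zero, add_zero]
  simpa [bilinExp] using hnn

end DelayedLQ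

end

/-! ### Solvability criterion -/

theorem mainTheorem4 {Ω : Type*} [MeasurableSpace Ω] (μ : Measure Ω) [IsProbabilityMeasure μ]
    {n m : ℕ} (S : DelayedLQ.LQData n m) (hd : 2 ≤ S.d)
    (w : ℕ → Ω → ℝ) (hw : DelayedLQ.IsNoise μ S.N w)
    (t : ℕ) (ht : t < S.N)
    (hQ : ∀ k, t ≤ k → k < S.N → (S.Q k).IsSymm)
    (hR : ∀ k, t ≤ k → k < S.N → (S.R k).IsSymm)
    (hG : S.G.IsSymm)
    (x : Ω → Fin n → ℝ) (hx : DelayedLQ.IsL2At μ w t x) :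
    (DelayedLQ.IsSolvable μ S w t x ↔
      (∀ k, t ≤ k → k < S.N → (DelayedLQ.matW S t k).PosSemidef) ∧
      (∀ u, DelayedLQ.IsAdmissible μ S w t u → ∀ k, t ≤ k → k < S.N →
        ∀ᵐ ω ∂μ, DelayedLQ.matH S t k *ᵥ
            DelayedLQ.delayedExp μ w S.d t k (DelayedLQ.shiftedState μ S w t x u k) ω
          ∈ LinearMap.range (DelayedLQ.matW S t k).mulVecLin)) ∧
    (DelayedLQ.IsSolvable μ S w t x →
      DelayedLQ.IsOptimalControl μ S w t x (DelayedLQ.feedback μ S w t x)) := by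
  have hopt := DelayedLQ.isOptimalControl_feedback S hd hw ht hQ hR hG hx
  have hnec : DelayedLQ.IsSolvable μ S w t x ↔ _ :=
    ⟨fun hsol => And.intro
      (fun k hk hkN =>
        DelayedLQ.posSemidef_matW_of_isSolvable S hd hw ht hQ hR hG hx hsol hk hkN)
      (fun u hu k hk hkN =>
        DelayedLQ.mem_range_of_isSolvable S hd hw ht hQ hR hG hx hsol hu hk hkN),
      fun h => ⟨_, hopt h.1 h.2⟩⟩
  exact ⟨hnec, fun hsol => hopt (hnec.1 hsol).1 (hnec.1 hsol).2⟩
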